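/- **Setting.** Let $\widehat W\in\mathbb R^{n\times n}$ be symmetric with eigenvalues $\lambda_1\ge\dots\ge\lambda_n\ge 0$ (with multiplicity), let $1\le L\le n-1$ and assume $\lambda_{L+1}>0$. Let $\varepsilon\in(0,1)$, $\varepsilon'\in(0,\tfrac13)$, $\alpha>0$ with $\alpha^2<\varepsilon'\lambda_{L+1}$, and $0<\eta<\big[4\max\{1,\lambda_1\}\big]^{-1}$. Let $W_1(k),W_2(k)$, $k\ge 0$, be the gradient descent iterates with constant step size $\eta$, $$W_j(k+1)=W_j(k)-\eta\,\nabla_{W_j}\mathcal L(W_1(k),W_2(k)),\quad j=1,2,\qquad \mathcal L(W_1,W_2)=\tfrac12\|W_2W_1-\widehat W\|_F^2,$$ started at $W_1(0)=W_2(0)=\alpha I$, and put $W(k)=W_2(k)W_1(k)$. Let $L'=\max\{\ell\in\{1,\dots,n\}:\varepsilon'\lambda_\ell>\alpha^2\}$. For a nonzero matrix $A$ let $r(A)=\|A\|_*/\|A\|$ (nuclear norm over spectral norm) be its effective rank, and let $\widehat W_L$ be any best approximation of $\widehat W$ in Frobenius norm by matrices of rank at most $L$. Define $$T_2^{\mathrm{Id}}(\lambda,\epsilon,\alpha,\eta)=\frac{1}{2\eta\lambda}\Big[\ln\Big(\frac{\lambda}{\alpha^2}-1\Big)-\ln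 2\Big]+\Big\lceil\sqrt{\tfrac{\lambda}{3}}\,\tfrac1\alpha\Big\rceil+\frac{\ln(\sqrt\lambda/\epsilon)-|\ln(1-\sqrt{1/3})|}{|\ln(1-2\eta\lambda/3)|},$$ $$T_0=\max\Big\{T_2^{\mathrm{Id}}\big(\lambda_1,\tfrac{\lambda_1}{2},\alpha,\eta\big),\ \max_{1\le\ell\le L}T_2^{\mathrm{Id}}\big(\lambda_\ell,\tfrac{\sqrt{\lambda_\ell}}{8}\varepsilon,\alpha,\eta\big)\Big\},$$ $$T_1=\frac{1}{2\eta\lambda_{L+1}}\Big[\ln\Big(\frac{\lambda_{L+1}}{\alpha^2}-1\Big)-\ln\Big(\frac1{\varepsilon'}-1\Big)\Big],\qquad K_\varepsilon=\ln(8/\varepsilon)-\big|\ln(1-\sqrt{1/3})\big| .$$ **Theorem.** For every integer $k\ge 0$ with $T_0\le k\le T_1$, $$\big|r(\widehat W_L)-r(W(k))\big|\le\varepsilon\, r(\widehat W_L)+6(L'-L)\frac{\lambda_{L+1}}{\lambda_1}\varepsilon'+(n-L')\frac{2\alpha^2}{\varepsilon'\lambda_1}.$$ Moreover: 1. Suppose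 $\lambda_1\ge 1$, $\lambda_L\ge 2(e+1)\alpha^2$, and for every $1\le\ell\le L-1$ $$\lambda_\ell-\lambda_{\ell+1}\ \ge\ \frac{1}{\kappa(\lambda_{\ell+1},\lambda_\ell)}\Big(\Big\lceil\sqrt{\tfrac{\lambda_\ell}{3}}\,\tfrac1\alpha\Big\rceil-\Big\lceil\sqrt{\tfrac{\lambda_{\ell+1}}{3}}\,\tfrac1\alpha\Big\rceil\Big),\qquad \kappa(x,y)=\frac{2\eta K_\varepsilon}{3\,(1-\frac23\eta x)\,\big(\ln(1-\frac23\eta y)\big)^2}.$$ Then $T_0=T_2^{\mathrm{Id}}\big(\lambda_L,\tfrac{\sqrt{\lambda_L}}8\varepsilon,\alpha,\eta\big)$, that is, $$T_0=\frac{1}{2\eta\lambda_L}\Big[\ln\Big(\frac{\lambda_L}{\alpha^2}-1\Big)-\ln 2\Big]+\Big\lceil\sqrt{\tfrac{\lambda_L}{3}}\,\tfrac1\alpha\Big\rceil+\frac{K_\varepsilon}{|\ln(1-2\eta\lambda_L/3)|},$$ while $T_1$ is given by the formula above. 2. If in addition to the assumptions of 1. we have $\lambda_L>\lambda_{L+1}$,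 $\alpha<\alpha^*$ and $\eta<\eta^*$, where $$\alpha^*=\exp\Big(\frac{1}{2(\lambda_L-\lambda_{L+1})}\Big(\lambda_L\ln(\varepsilon'\lambda_{L+1})-\lambda_{L+1}\big(\ln\lambda_L-\ln 2+3K_\varepsilon\big)\Big)\Big),$$ $$\eta^*=\frac{\frac1{\lambda_{L+1}}\Big[\ln\Big(\frac{\lambda_{L+1}}{\alpha^2}-1\Big)-\ln\Big(\frac1{\varepsilon'}-1\Big)\Big]-\frac1{\lambda_L}\Big[\ln\Big(\frac{\lambda_L}{\alpha^2}-1\Big)-\ln 2+3K_\varepsilon\Big]}{2\Big\lceil\sqrt{\frac{\lambda_L}{3}}\,\frac1\alpha\Big\rceil},$$ then $T_0<T_1$. -/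

import Mathlib

/-- The squared Frobenius norm of a real matrix. -/
def frobSq {n : ℕ} (A : Matrix (Fin n) (Fin n) ℝ) : ℝ :=
  ∑ i, ∑ j, A i j ^ 2

/-- The nuclear norm: the sum of the singular values, that is, of the square roots of the
eigenvalues (with multiplicity) of the Gram matrix of `A`. -/
noncomputable def nuclearNorm {n : ℕ} (A : Matrix (Fin n) (Fin n) ℝ) : ℝ :=
  ∑ i, √((Matrix.isHermitian_conjTranspose_mul_self A).eigenvalues i)

/-- The spectral norm: the operator norm with respect to the Euclidean norm. -/
noncomputable def spectralNorm2 {n : ℕ} (A : Matrix (Fin n) (Fin n) ℝ) : ℝ :=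
  ‖Matrix.toEuclideanCLM (n := Fin n) (𝕜 := ℝ) A‖

/-- The effective rank: nuclear norm over spectral norm. -/
noncomputable def effRank {n : ℕ} (A : Matrix (Fin n) (Fin n) ℝ) : ℝ :=
  nuclearNorm A / spectralNorm2 A

/-- `B` is a best approximation of `A`, in Frobenius norm, among the matrices of rank at
most `L`. -/
def IsBestRankApprox {n : ℕ} (A : Matrix (Fin n) (Fin n) ℝ) (L : ℕ)
    (B : Matrix (Fin n) (Fin n) ℝ) : Prop :=
  B.rank ≤ L ∧ ∀ C : Matrix (Fin n) (Fin n) ℝ, C.rank ≤ L → frobSq (A - B) ≤ frobSq (A - C)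

/-- `lam 1 ≥ lam 2 ≥ … ≥ lam n` are the eigenvalues of `A`, listed with multiplicity.
Values of `lam` outside `{1, …, n}` play no role. -/
def IsOrderedSpectrum {n : ℕ} (A : Matrix (Fin n) (Fin n) ℝ) (lam : ℕ → ℝ) : Prop :=
  AntitoneOn lam (Set.Icc 1 n) ∧
    A.charpoly = ∏ l ∈ Finset.Icc 1 n, (Polynomial.X - Polynomial.C (lam l))

/-- The square loss of the two-factor matrix factorization problem, with factor one half. -/
noncomputable def factLoss {n : ℕ} (What X₁ X₂ : Matrix (Fin n) (Fin n) ℝ) : ℝ :=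
  1 / 2 * frobSq (X₂ * X₁ - What)

/-- The gradient of a scalar function of a matrix: the matrix of its partial derivatives. -/
noncomputable def matGrad {n : ℕ} (F : Matrix (Fin n) (Fin n) ℝ → ℝ)
    (X : Matrix (Fin n) (Fin n) ℝ) : Matrix (Fin n) (Fin n) ℝ :=
  Matrix.of fun i j => deriv (fun t : ℝ => F (X + t • Matrix.single i j (1 : ℝ))) 0

/-- `(W₁ k, W₂ k)` is the gradient descent for `factLoss What` with constant step size `η`,
started at `W₁ 0 = W₂ 0 = α I`. -/
def IsGradientDescent {n : ℕ} (What : Matrix (Fin n) (Fin n) ℝ) (α η : ℝ)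
    (W₁ W₂ : ℕ → Matrix (Fin n) (Fin n) ℝ) : Prop :=
  W₁ 0 = α • (1 : Matrix (Fin n) (Fin n) ℝ) ∧
  W₂ 0 = α • (1 : Matrix (Fin n) (Fin n) ℝ) ∧
  ∀ k : ℕ,
    W₁ (k + 1) = W₁ k - η • matGrad (fun X => factLoss What X (W₂ k)) (W₁ k) ∧
    W₂ (k + 1) = W₂ k - η • matGrad (fun X => factLoss What (W₁ k) X) (W₂ k)

/-- The time `T₂^Id(x, ε, α, η)`. -/
noncomputable def timeT2 (x ε α η : ℝ) : ℝ :=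
  1 / (2 * η * x) * (Real.log (x / α ^ 2 - 1) - Real.log 2)
    + (⌈√(x / 3) * (1 / α)⌉ : ℝ)
    + (Real.log (√x / ε) - |Real.log (1 - √(1 / 3))|) / |Real.log (1 - 2 * η * x / 3)|

/-- The start `T₀` of the low-rank window: a maximum over `l = 1, …, L`. -/
noncomputable def timeT0 (lam : ℕ → ℝ) (L : ℕ) (hL : 1 ≤ L) (ε α η : ℝ) : ℝ :=
  max (timeT2 (lam 1) (lam 1 / 2) α η)
    ((Finset.Icc 1 L).sup' (Finset.nonempty_Icc.mpr hL)
      (fun l => timeT2 (lam l) (√(lam l) / 8 * ε) α η))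

/-- The end `T₁` of the low-rank window, as a function of `x = λ_{L+1}`. -/
noncomputable def timeT1 (x ε' α η : ℝ) : ℝ :=
  1 / (2 * η * x) * (Real.log (x / α ^ 2 - 1) - Real.log (1 / ε' - 1))

/-- The constant `K_ε`. -/
noncomputable def constK (ε : ℝ) : ℝ :=
  Real.log (8 / ε) - |Real.log (1 - √(1 / 3))|

/-- The decay rate `κ(x, y)`, where `x ≤ y` are two consecutive eigenvalues. -/
noncomputable def decayRate (ε η x y : ℝ) : ℝ :=
  2 * η * constK ε / (3 * (1 - 2 / 3 * η * x) * Real.log (1 - 2 / 3 * η * y) ^ 2)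

/-- The threshold `α*` for the initialization, with `x = λ_{L+1}` and `y = λ_L`. -/
noncomputable def alphaStar (ε ε' x y : ℝ) : ℝ :=
  Real.exp (1 / (2 * (y - x)) *
    (y * Real.log (ε' * x) - x * (Real.log y - Real.log 2 + 3 * constK ε)))

/-- The threshold `η*` for the step size, with `x = λ_{L+1}` and `y = λ_L`. -/
noncomputable def etaStar (ε ε' α x y : ℝ) : ℝ :=
  (1 / x * (Real.log (x / α ^ 2 - 1) - Real.log (1 / ε' - 1))
      - 1 / y * (Real.log (y / α ^ 2 - 1) - Real.log 2 + 3 * constK ε))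
    / (2 * (⌈√(y / 3) * (1 / α)⌉ : ℝ))

/-! Since both factors start at a multiple of the identity, an orthonormal eigenbasis of the target
diagonalizes them for all time (`IsGradientDescent.eq_conj_diagonal`). Gradient descent splits into
one scalar recursion d ↦ d + η d (λ - d²) per eigenvalue, with fixed point √λ. Under the gradient
flow the odds λ/d² - 1 decay exactly like exp(-2ηλk), so large eigenvalues are learned first. In the
window the leading L have converged while the next one is still small.

Two comparisons with the flow make this discrete. While d² is safely below λ/3, a step shrinks the
odds at most as much as the flow does, so the component of λ_{L+1} stays below ε'λ_{L+1} until T₁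
(`factorIter_sq_le_of_le_timeT1`); monotonicity in the eigenvalue (`factorIter_mono`) covers the
later ones. Conversely, the iterates lag behind the flow by at most log(d/α) steps
(`le_flowTime_of_sq_lt`), and beyond λ/3 they converge linearly, which gives
`sqrt_sub_le_of_timeT2_le`.

The effective rank of W(k) is then a ratio of explicit sums. A best approximation need not be unique
or diagonal, but it is the target times a commuting projection, which fixes its trace and norm
(`IsBestRankApprox.effRank_eq_of_diagonal`). The bound follows term by term. For the explicit
window, the gap condition makes T₂ largest at λ_L, and T₀ < T₁ reduces to an inequality linear in η.
-/

/-! ### The scalar recursion: invariant region and monotonicity. -/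

/-- The recursion followed by each eigenvalue of the factors under gradient descent. -/
noncomputable def factorIter (α η l : ℝ) : ℕ → ℝ
  | 0 => α
  | k + 1 => factorIter α η l k + η * factorIter α η l k * (l - factorIter α η l k ^ 2)

theorem factorIter_succ (α η l : ℝ) (k : ℕ) : factorIter α η l (k + 1) =
    factorIter α η l k + η * factorIter α η l k * (l - factorIter α η l k ^ 2) := rfl

/-- Below the fixed point `√l`, the iterates stay positive and below it. -/
theorem factorIter_pos_and_sq_lt {α η l : ℝ} (hα : 0 < α) (hη : 0 < η) (hl : α ^ 2 < l)
    (hηl : η * l ≤ 1 / 4) (k : ℕ) : 0 < factorIter α η l k ∧ factorIter α η l k ^ 2 < l := by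
  induction k with
  | zero => exact ⟨hα, hl⟩
  | succ k ih =>
    obtain ⟨h0, h1⟩ := ih
    rw [factorIter_succ]
    set d := factorIter α η l k
    have hl0 : 0 < l := (by positivity : 0 < α ^ 2).trans hl
    have hs : √l ^ 2 = l := Real.sq_sqrt hl0.le
    have hs0 : 0 < √l := Real.sqrt_pos.2 hl0
    have hds : d < √l := Real.lt_sqrt_of_sq_lt h1
    have hpos : 0 < d + η * d * (l - d ^ 2) := by
      have := sub_pos.2 h1
      positivity
    refine ⟨hpos, ?_⟩
    have hlt : d + η * d * (l - d ^ 2) < √l := by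
      have h2 : 0 < 1 - η * (d * (√l + d)) := by
        have : d * (√l + d) ≤ 2 * l := by nlinarith
        nlinarith
      -- Factoring l - d² over √l shows that the distance to the fixed point is multiplied by 1 -
      -- ηd(√l + d), positive because ηl ≤ 1/4.
      have h3 : √l - (d + η * d * (l - d ^ 2)) = (√l - d) * (1 - η * (d * (√l + d))) := by
        linear_combination (η * d) * hs
      nlinarith [mul_pos (sub_pos.2 hds) h2]
    calc _ < √l ^ 2 := pow_lt_pow_left₀ hlt hpos.le two_ne_zero
      _ = l := hs

/-- Eigenvalues below α², zero included, need a bound too: there the iterates decrease from α and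
stay above √l. -/
theorem factorIter_nonneg_and_le_sup {α η l : ℝ} (hα : 0 < α) (hη : 0 < η) (hl0 : 0 ≤ l)
    (hηl : η * l ≤ 1 / 4) (hηα : η * α ^ 2 ≤ 1 / 4) (k : ℕ) :
    0 ≤ factorIter α η l k ∧ factorIter α η l k ^ 2 ≤ max l (α ^ 2) := by
  rcases lt_or_ge (α ^ 2) l with hl | hl
  · obtain ⟨h0, h1⟩ := factorIter_pos_and_sq_lt hα hη hl hηl k
    exact ⟨h0.le, h1.le.trans (le_max_left _ _)⟩
  · suffices h : √l ≤ factorIter α η l k ∧ factorIter α η l k ≤ α by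
      have h0 := (Real.sqrt_nonneg l).trans h.1
      exact ⟨h0, (pow_le_pow_left₀ h0 h.2 2).trans (le_max_right _ _)⟩
    induction k with
    | zero => exact ⟨Real.sqrt_le_iff.2 ⟨hα.le, hl⟩, le_rfl⟩
    | succ k ih =>
      obtain ⟨h0, h1⟩ := ih
      rw [factorIter_succ]
      set d := factorIter α η l k
      have hs : √l ^ 2 = l := Real.sq_sqrt hl0
      have hs0 : 0 ≤ √l := Real.sqrt_nonneg l
      have hd0 : 0 ≤ d := hs0.trans h0
      constructor
      · have h2 : 0 ≤ 1 - η * (d * (√l + d)) := by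
          have : d * (√l + d) ≤ 2 * α ^ 2 := by nlinarith
          nlinarith
        have h3 : √l - (d + η * d * (l - d ^ 2)) = (√l - d) * (1 - η * (d * (√l + d))) := by
          linear_combination (η * d) * hs
        nlinarith [mul_nonneg (sub_nonneg.2 h0) h2]
      · have : l ≤ d ^ 2 := by rw [← hs]; gcongr
        nlinarith [mul_nonneg (mul_nonneg hη.le hd0) (sub_nonneg.2 this)]

/-- The update is increasing in l, and in d as long as 3ηd² ≤ 1 + ηl. Hence the iterates inherit the
order of the spectrum: the first is the largest, and the one for λ_{L+1} dominates all later ones.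
-/
theorem factorIter_mono {α η l l' : ℝ} (hα : 0 < α) (hη : 0 < η) (hl0 : 0 ≤ l) (hll : l ≤ l')
    (hηl : η * l' ≤ 1 / 4) (hηα : η * α ^ 2 ≤ 1 / 4) (k : ℕ) :
    factorIter α η l k ≤ factorIter α η l' k := by
  induction k with
  | zero => exact le_rfl
  | succ k ih =>
    obtain ⟨h0, -⟩ := factorIter_nonneg_and_le_sup hα hη hl0
      ((mul_le_mul_of_nonneg_left hll hη.le).trans hηl) hηα k
    obtain ⟨h0', h1⟩ := factorIter_nonneg_and_le_sup hα hη (hl0.trans hll) hηl hηα k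
    rw [factorIter_succ, factorIter_succ]
    set d := factorIter α η l k
    set d' := factorIter α η l' k
    have h2 : η * d' ^ 2 ≤ 1 / 4 := by
      rcases le_max_iff.1 h1 with h | h
      · exact (mul_le_mul_of_nonneg_left h hη.le).trans hηl
      · exact (mul_le_mul_of_nonneg_left h hη.le).trans hηα
    have h3 : d ^ 2 + d * d' + d' ^ 2 ≤ 3 * d' ^ 2 := by nlinarith
    have h4 : 0 ≤ 1 + η * l' - η * (d ^ 2 + d * d' + d' ^ 2) := by
      have : 0 ≤ η * l' := mul_nonneg hη.le (hl0.trans hll)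
      nlinarith
    have h5 := mul_nonneg (sub_nonneg.2 ih) h4
    have h6 := mul_nonneg (mul_nonneg hη.le h0) (sub_nonneg.2 hll)
    nlinarith

/-! ### Comparison with the gradient flow: the components that are still small. -/

/-- One step of the recursion in terms of the odds `l / d ^ 2 - 1`. -/
theorem odds_step {η l d : ℝ} (hη : 0 < η) (hd : 0 < d) (hdl : d ^ 2 < l) :
    l / (d + η * d * (l - d ^ 2)) ^ 2 - 1 = (l / d ^ 2 - 1) *
      (1 - η * l * (2 + η * (l - d ^ 2)) / (1 + η * (l - d ^ 2)) ^ 2) := by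
  have h1 := sub_pos.2 hdl
  have h2 : 0 < 1 + η * (l - d ^ 2) := by positivity
  have h3 : d + η * d * (l - d ^ 2) = d * (1 + η * (l - d ^ 2)) := by ring
  rw [h3]
  field_simp
  ring

/-- In the convex regime, one step shrinks the odds at most as much as the gradient flow. -/
theorem exp_neg_le_odds_factor {a b : ℝ} (ha : 0 < a) (ha' : a ≤ 1 / 4)
    (hb : a * (2 + 4 * a) / (3 + 4 * a) ≤ b) :
    Real.exp (-(2 * a)) ≤ 1 - a * (2 + b) / (1 + b) ^ 2 := by
  set c := a * (2 + 4 * a) / (3 + 4 * a) with hc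
  have hc0 : 0 < c := by positivity
  -- The factor increases with b, so the least admissible value b = c is the worst case; there the
  -- cubic Taylor polynomial of exp(2a) suffices.
  have hanti : (2 + b) / (1 + b) ^ 2 ≤ (2 + c) / (1 + c) ^ 2 := by
    have hb0 : 0 < b := hc0.trans_le hb
    rw [div_le_div_iff₀ (by positivity) (by positivity)]
    nlinarith [mul_pos hb0 hc0, mul_nonneg (sub_nonneg.2 hb) (mul_pos hb0 hc0).le]
  have hexp : 1 + 2 * a + 2 * a ^ 2 + 4 / 3 * a ^ 3 ≤ Real.exp (2 * a) := by
    have := Real.sum_le_exp_of_nonneg (x := 2 * a) (by positivity) 4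
    simp [Finset.sum_range_succ, Nat.factorial] at this
    nlinarith
  have hpoly : 1 / (1 + 2 * a + 2 * a ^ 2 + 4 / 3 * a ^ 3) ≤ 1 - a * ((2 + c) / (1 + c) ^ 2) := by
    have h1 : 1 + c = (3 + 6 * a + 4 * a ^ 2) / (3 + 4 * a) := by rw [hc]; field_simp; ring
    have h2 : 2 + c = (6 + 10 * a + 4 * a ^ 2) / (3 + 4 * a) := by rw [hc]; field_simp; ring
    have h3 : 1 - a * ((2 + c) / (1 + c) ^ 2) =
        ((3 + 6 * a + 4 * a ^ 2) ^ 2 - a * (6 + 10 * a + 4 * a ^ 2) * (3 + 4 * a)) /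
          (3 + 6 * a + 4 * a ^ 2) ^ 2 := by
      rw [h1, h2]; field_simp
    rw [h3, div_le_div_iff₀ (by positivity) (by positivity), ← sub_nonneg]
    have ha3 : a ^ 3 ≤ 1 := pow_le_one₀ ha.le (by linarith)
    -- This is exactly the difference left after clearing denominators.
    have : 0 ≤ a ^ 3 * (8 + 12 * a - 16 / 3 * a ^ 3) :=
      mul_nonneg (by positivity) (by linarith)
    linarith
  rw [Real.exp_neg, ← one_div, mul_div_assoc]
  calc 1 / Real.exp (2 * a) ≤ 1 / (1 + 2 * a + 2 * a ^ 2 + 4 / 3 * a ^ 3) := by gcongr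
    _ ≤ _ := hpoly
    _ ≤ _ := by gcongr

/-- T₁ is the time at which the odds of the flow reach 1/ε' - 1, that is, d² = ε'l. The true odds
stay above those of the flow throughout the window, since ε' < 1/3 keeps the flow in the regime of
`exp_neg_le_odds_factor`. -/
theorem factorIter_sq_le_of_le_timeT1 {α η l ε' : ℝ} (hα : 0 < α) (hη : 0 < η)
    (hε0 : 0 < ε') (hε' : ε' < 1 / 3) (hl : α ^ 2 < ε' * l) (hηl : η * l ≤ 1 / 4) {k : ℕ}
    (hk : (k : ℝ) ≤ timeT1 l ε' α η) : factorIter α η l k ^ 2 ≤ ε' * l := by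
  have hα2 : 0 < α ^ 2 := by positivity
  have hl0 : 0 < l := by
    by_contra h
    nlinarith
  have hαl : α ^ 2 < l := by nlinarith
  have hu0 : 0 < l / α ^ 2 - 1 := by rw [sub_pos, one_lt_div hα2]; exact hαl
  have hU : 2 < 1 / ε' - 1 := by
    have : 3 < 1 / ε' := by rw [lt_div_iff₀ hε0]; linarith
    linarith
  have ha : 0 < η * l := by positivity
  have hwin : ∀ j : ℕ, (j : ℝ) ≤ timeT1 l ε' α η →
      1 / ε' - 1 ≤ (l / α ^ 2 - 1) * Real.exp (-(2 * (η * l)) * j) := by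
    intro j hj
    rw [timeT1, one_div_mul_eq_div, le_div_iff₀ (by positivity)] at hj
    rw [← Real.log_le_log_iff (by linarith) (by positivity),
      Real.log_mul hu0.ne' (Real.exp_pos _).ne', Real.log_exp]
    linarith
  have hodds : ∀ j : ℕ, (j : ℝ) ≤ timeT1 l ε' α η →
      (l / α ^ 2 - 1) * Real.exp (-(2 * (η * l)) * j) ≤ l / factorIter α η l j ^ 2 - 1 := by
    intro j
    induction j with
    | zero => intro _; simp [factorIter]
    | succ j ih =>
      intro hj
      obtain ⟨hd, hdl⟩ := factorIter_pos_and_sq_lt hα hη hαl hηl j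
      have hj1 := hwin _ hj
      push_cast at hj hj1 ⊢
      have ih' := ih (by linarith)
      have hsplit : Real.exp (-(2 * (η * l)) * (j + 1)) =
          Real.exp (-(2 * (η * l)) * j) * Real.exp (-(2 * (η * l))) := by
        rw [← Real.exp_add]; congr 1; ring
      rw [hsplit] at hj1 ⊢
      rw [factorIter_succ, odds_step hη hd hdl]
      set d := factorIter α η l j
      set v := (l / α ^ 2 - 1) * Real.exp (-(2 * (η * l)) * j) with hv
      rw [← mul_assoc, ← hv] at hj1 ⊢
      have hv0 : 0 < v := by positivity
      -- The flow odds still exceed 2 one step later, so now they are at least 2 exp(2ηl). The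
      -- resulting l/d² ≥ 3 + 4ηl is what produces the threshold on b.
      have hvlow : 2 + 4 * (η * l) ≤ v := by
        have h1 : 1 + 2 * (η * l) ≤ Real.exp (2 * (η * l)) := by
          linarith [Real.add_one_le_exp (2 * (η * l))]
        rw [Real.exp_neg, ← div_eq_mul_inv] at hj1
        have h2 := (le_div_iff₀ (Real.exp_pos _)).1 hj1
        nlinarith
      have hb : η * l * (2 + 4 * (η * l)) / (3 + 4 * (η * l)) ≤ η * (l - d ^ 2) := by
        have h1 := hvlow.trans ih'
        have h2 : d ^ 2 * (3 + 4 * (η * l)) ≤ l := by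
          have : 3 + 4 * (η * l) ≤ l / d ^ 2 := by linarith
          rw [le_div_iff₀ (by positivity)] at this
          linarith
        rw [div_le_iff₀ (by positivity)]
        nlinarith
      have := exp_neg_le_odds_factor ha hηl hb
      exact mul_le_mul ih' this (Real.exp_pos _).le (hv0.le.trans ih')
  obtain ⟨hd, -⟩ := factorIter_pos_and_sq_lt hα hη hαl hηl k
  have h := (hwin k hk).trans (hodds k hk)
  have h1 : 1 / ε' ≤ l / factorIter α η l k ^ 2 := by linarith
  rw [div_le_div_iff₀ hε0 (by positivity)] at h1
  linarith

/-! ### Comparison with the gradient flow: convergence of the leading components. -/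

/-- One step advances the gradient flow clock, corrected by a logarithmic term, by at least
one. -/
theorem two_mul_le_neg_log_odds_factor {a b : ℝ} (hb : 0 < b) (hba : b ≤ a) (hb1 : b ≤ 1)
    (hw : a * (2 + b) / (1 + b) ^ 2 < 1) :
    2 * a ≤ -Real.log (1 - a * (2 + b) / (1 + b) ^ 2) + 2 * a * Real.log (1 + b) := by
  set w := a * (2 + b) / (1 + b) ^ 2 with hwdef
  have ha : 0 < a := hb.trans_le hba
  have hw0 : 0 < w := by positivity
  have h1 : w + w ^ 2 / 2 ≤ -Real.log (1 - w) := by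
    have h2 := Real.le_log_one_add_of_nonneg (x := w / (1 - w))
      (div_nonneg hw0.le (by linarith))
    have h3 : 1 + w / (1 - w) = (1 - w)⁻¹ := by
      have : 1 - w ≠ 0 := by linarith
      field_simp
      ring
    rw [h3, Real.log_inv] at h2
    refine le_trans ?_ h2
    have h4 : 2 * (w / (1 - w)) / (w / (1 - w) + 2) = 2 * w / (2 - w) := by
      have : 1 - w ≠ 0 := by linarith
      have : 2 - w ≠ 0 := by linarith
      have : w + 2 * (1 - w) ≠ 0 := by linarith
      field_simp
      ring
    rw [h4, le_div_iff₀ (by linarith)]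
    nlinarith [pow_pos hw0 3]
  have h2 : b / (1 + b) ≤ Real.log (1 + b) := by
    have := Real.one_sub_inv_le_log_of_pos (x := 1 + b) (by linarith)
    refine le_trans (le_of_eq ?_) this
    field_simp
    ring
  -- To first order in w there is a deficit of ab/(1 + b)²; the term w²/2 covers it because b ≤ a
  -- and b ≤ 1.
  have h3 : 2 * a ≤ w + w ^ 2 / 2 + 2 * a * (b / (1 + b)) := by
    have h4 : w + w ^ 2 / 2 + 2 * a * (b / (1 + b)) - 2 * a =
        a * (a * (2 + b) ^ 2 / 2 - b * (1 + b) ^ 2) / (1 + b) ^ 4 := by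
      rw [hwdef]; field_simp; ring
    have h5 : 0 ≤ a * (2 + b) ^ 2 / 2 - b * (1 + b) ^ 2 := by
      have : b * (2 + b) ^ 2 ≤ a * (2 + b) ^ 2 := by gcongr
      nlinarith [mul_nonneg hb.le (sub_nonneg.2 hb1), mul_nonneg hb.le (mul_nonneg hb.le (sub_nonneg.2 hb1)), mul_nonneg (mul_nonneg hb.le hb.le) (mul_nonneg hb.le (sub_nonneg.2 hb1))]
    have : 0 ≤ a * (a * (2 + b) ^ 2 / 2 - b * (1 + b) ^ 2) / (1 + b) ^ 4 := by positivity
    linarith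
  have : 2 * a * (b / (1 + b)) ≤ 2 * a * Real.log (1 + b) := by gcongr
  linarith

/-- The correction log(1 + b) in each step is the logarithm of the ratio of consecutive iterates, so
the corrections telescope to log(d/α). While d² < l/3 this is at most log(√(l/3)/α). -/
theorem le_flowTime_of_sq_lt {α η l : ℝ} (hα : 0 < α) (hη : 0 < η) (hl : α ^ 2 < l)
    (hηl : η * l ≤ 1 / 4) {k : ℕ} (hk : factorIter α η l k ^ 2 < l / 3) :
    (k : ℝ) ≤ 1 / (2 * η * l) * (Real.log (l / α ^ 2 - 1) - Real.log 2)
      + Real.log (√(l / 3) * (1 / α)) := by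
  have hl0 : 0 < l := (by positivity : 0 < α ^ 2).trans hl
  have hu0 : 0 < l / α ^ 2 - 1 := by rw [sub_pos, one_lt_div (by positivity)]; exact hl
  have hpot : ∀ j : ℕ, 2 * (η * l) * j ≤ Real.log (l / α ^ 2 - 1) -
      Real.log (l / factorIter α η l j ^ 2 - 1) +
      2 * (η * l) * (Real.log (factorIter α η l j) - Real.log α) := by
    intro j
    induction j with
    | zero => simp [factorIter]
    | succ j ih =>
      obtain ⟨hd, hdl⟩ := factorIter_pos_and_sq_lt hα hη hl hηl j
      obtain ⟨hd', hdl'⟩ := factorIter_pos_and_sq_lt hα hη hl hηl (j + 1)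
      have hu : 0 < l / factorIter α η l j ^ 2 - 1 := by
        rw [sub_pos, one_lt_div (by positivity)]; exact hdl
      have hu' : 0 < l / factorIter α η l (j + 1) ^ 2 - 1 := by
        rw [sub_pos, one_lt_div (by positivity)]; exact hdl'
      rw [factorIter_succ] at hu' ⊢
      rw [odds_step hη hd hdl] at hu' ⊢
      set d := factorIter α η l j
      have hf := pos_of_mul_pos_right hu' hu.le
      have hb : 0 < η * (l - d ^ 2) := mul_pos hη (sub_pos.2 hdl)
      have hba : η * (l - d ^ 2) ≤ η * l := by gcongr; nlinarith
      have hstep := two_mul_le_neg_log_odds_factor hb hba (by linarith) (by linarith)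
      rw [Real.log_mul hu.ne' hf.ne', show d + η * d * (l - d ^ 2) =
        d * (1 + η * (l - d ^ 2)) by ring, Real.log_mul hd.ne' (by positivity)]
      push_cast
      linarith
  obtain ⟨hd, hdl⟩ := factorIter_pos_and_sq_lt hα hη hl hηl k
  have h := hpot k
  set d := factorIter α η l k
  have h1 : Real.log 2 ≤ Real.log (l / d ^ 2 - 1) := by
    refine Real.log_le_log two_pos ?_
    have : 3 ≤ l / d ^ 2 := by rw [le_div_iff₀ (by positivity)]; linarith
    linarith
  have h2 : Real.log d ≤ Real.log (√(l / 3)) :=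
    Real.log_le_log hd (Real.le_sqrt_of_sq_le hk.le)
  have h3 : Real.log (√(l / 3) * (1 / α)) = Real.log (√(l / 3)) - Real.log α := by
    rw [mul_one_div, Real.log_div (by positivity) hα.ne']
  rw [h3]
  have ha : 0 < 2 * (η * l) := by positivity
  have h4 : 2 * (η * l) * k ≤ (Real.log (l / α ^ 2 - 1) - Real.log 2) +
      2 * (η * l) * (Real.log (√(l / 3)) - Real.log α) := by
    have : 2 * (η * l) * (Real.log d - Real.log α) ≤
      2 * (η * l) * (Real.log (√(l / 3)) - Real.log α) := by gcongr
    linarith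
  have h5 : (k : ℝ) ≤ ((Real.log (l / α ^ 2 - 1) - Real.log 2) +
      2 * (η * l) * (Real.log (√(l / 3)) - Real.log α)) / (2 * (η * l)) := by
    rw [le_div_iff₀ ha]; linarith
  refine h5.trans (le_of_eq ?_)
  field_simp

/-- Once `d ^ 2 ≥ l / 3`, the distance to the fixed point contracts geometrically. -/
theorem sqrt_sub_factorIter_le {α η l : ℝ} (hα : 0 < α) (hη : 0 < η) (hl : α ^ 2 < l)
    (hηl : η * l ≤ 1 / 4) {k₀ : ℕ} (hk₀ : l / 3 ≤ factorIter α η l k₀ ^ 2) (m : ℕ) :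
    l / 3 ≤ factorIter α η l (k₀ + m) ^ 2 ∧ √l - factorIter α η l (k₀ + m) ≤
      √l * (1 - √(1 / 3)) * (1 - 2 * η * l / 3) ^ m := by
  have hl0 : 0 < l := (by positivity : 0 < α ^ 2).trans hl
  have hs : √l ^ 2 = l := Real.sq_sqrt hl0.le
  have h3 : √l * √(1 / 3) = √(l / 3) := by
    rw [← Real.sqrt_mul hl0.le]; congr 1; ring
  have hq : 0 ≤ 1 - 2 * η * l / 3 := by nlinarith
  induction m with
  | zero =>
    obtain ⟨hd, -⟩ := factorIter_pos_and_sq_lt hα hη hl hηl k₀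
    refine ⟨hk₀, ?_⟩
    have := Real.sqrt_le_iff.2 ⟨hd.le, hk₀⟩
    rw [← h3] at this
    simp only [add_zero, pow_zero]
    linarith
  | succ m ih =>
    obtain ⟨ih1, ih2⟩ := ih
    obtain ⟨hd, hdl⟩ := factorIter_pos_and_sq_lt hα hη hl hηl (k₀ + m)
    rw [← add_assoc, factorIter_succ]
    set d := factorIter α η l (k₀ + m)
    have hds : d < √l := Real.lt_sqrt_of_sq_lt hdl
    constructor
    · refine ih1.trans (pow_le_pow_left₀ hd.le ?_ 2)
      have := mul_pos (mul_pos hη hd) (sub_pos.2 hdl)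
      linarith
    · have e : √l - (d + η * d * (l - d ^ 2)) = (√l - d) * (1 - η * (d * (√l + d))) := by
        linear_combination (η * d) * hs
      -- Both d√l and d² are at least l/3, whence the rate 2/3.
      have hdd : 2 * l / 3 ≤ d * (√l + d) := by nlinarith
      rw [e, pow_succ, ← mul_assoc (√l * _)]
      have hfac : 1 - η * (d * (√l + d)) ≤ 1 - 2 * η * l / 3 := by nlinarith
      exact (mul_le_mul_of_nonneg_left hfac (sub_nonneg.2 hds.le)).trans
        (mul_le_mul_of_nonneg_right ih2 hq)

/-- The first two terms of T₂ bound the time to reach d² ≥ l/3; the third counts the contraction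
steps from there to accuracy δ. -/
theorem sqrt_sub_le_of_timeT2_le {α η l δ : ℝ} (hα : 0 < α) (hη : 0 < η) (hl : 3 * α ^ 2 < l)
    (hηl : η * l ≤ 1 / 4) (hδ : 0 < δ)
    (hK : 0 ≤ Real.log (√l / δ) - |Real.log (1 - √(1 / 3))|) {k : ℕ}
    (hk : timeT2 l δ α η ≤ k) : √l - factorIter α η l k ≤ δ := by
  have hα2 : 0 < α ^ 2 := by positivity
  have hαl : α ^ 2 < l := by linarith
  have hl0 : 0 < l := hα2.trans hαl
  set x := √(l / 3) * (1 / α) with hx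
  have hx1 : 1 < x := by
    rw [hx, mul_one_div, one_lt_div hα]
    exact Real.lt_sqrt_of_sq_lt (by linarith)
  set A := 1 / (2 * η * l) * (Real.log (l / α ^ 2 - 1) - Real.log 2) with hA
  have hA0 : 0 ≤ A := by
    refine mul_nonneg (by positivity) (sub_nonneg.2 (Real.log_le_log two_pos ?_))
    have : 3 < l / α ^ 2 := by rw [lt_div_iff₀ hα2]; linarith
    linarith
  have hlog0 : 0 < Real.log x := Real.log_pos hx1
  set k₀ := ⌊A + Real.log x⌋₊ + 1 with hk0
  have hk₀gt : A + Real.log x < k₀ := by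
    rw [hk0]; push_cast; exact Nat.lt_floor_add_one _
  -- Since log x ≤ x - 1, replacing log x by ⌈x⌉ leaves room for rounding up to the integer `k₀`.
  have hk₀le : (k₀ : ℝ) ≤ A + ⌈x⌉ := by
    rw [hk0]; push_cast
    have h1 := Nat.floor_le (by positivity : 0 ≤ A + Real.log x)
    have h2 := Real.log_le_sub_one_of_pos (zero_lt_one.trans hx1)
    have h3 := Int.le_ceil x
    linarith
  have hhit : l / 3 ≤ factorIter α η l k₀ ^ 2 := by
    by_contra! h
    exact absurd (le_flowTime_of_sq_lt hα hη hαl hηl h) (not_le.2 hk₀gt)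
  have hq0 : 0 < 1 - 2 * η * l / 3 := by nlinarith
  have hq1 : 1 - 2 * η * l / 3 < 1 := by
    have : 0 < 2 * η * l / 3 := by positivity
    linarith
  have hlq : Real.log (1 - 2 * η * l / 3) < 0 := Real.log_neg hq0 hq1
  rw [timeT2, ← hA, ← hx] at hk
  rw [abs_of_neg hlq] at hk
  have hs3 : √(1 / 3 : ℝ) < 1 := by
    rw [Real.sqrt_lt' one_pos]; norm_num
  have hlc : Real.log (1 - √(1 / 3)) < 0 := by
    refine Real.log_neg (by linarith) ?_
    have : 0 < √(1 / 3 : ℝ) := by positivity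
    linarith
  rw [abs_of_neg hlc] at hk hK
  have hM0 : 0 ≤ (Real.log (√l / δ) - -Real.log (1 - √(1 / 3))) /
    -Real.log (1 - 2 * η * l / 3) := div_nonneg hK (by linarith)
  have hkk : k₀ ≤ k := by
    have : (k₀ : ℝ) ≤ k := by linarith
    exact_mod_cast this
  obtain ⟨m, rfl⟩ := Nat.exists_eq_add_of_le hkk
  refine (sqrt_sub_factorIter_le hα hη hαl hηl hhit m).2.trans ?_
  have hm : (Real.log (√l / δ) - -Real.log (1 - √(1 / 3))) /
    -Real.log (1 - 2 * η * l / 3) ≤ m := by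
    push_cast at hk
    linarith
  rw [div_le_iff₀ (by linarith)] at hm
  have hsl : 0 < √l := Real.sqrt_pos.2 hl0
  have hc : 0 < 1 - √(1 / 3 : ℝ) := by linarith
  rw [← Real.log_le_log_iff (by positivity) hδ, Real.log_mul (by positivity) (by positivity),
    Real.log_mul (by positivity) (by positivity), Real.log_pow]
  rw [Real.log_div hsl.ne' hδ.ne'] at hm
  linarith

/-! ### Orthogonal diagonalization, norms and effective rank. -/

open Matrix in
/-- A real symmetric matrix is orthogonally diagonalizable. -/
theorem exists_orthogonal_diagonalization {n : ℕ} {A : Matrix (Fin n) (Fin n) ℝ}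
    (hA : A.IsHermitian) :
    ∃ Q : Matrix (Fin n) (Fin n) ℝ, Qᵀ * Q = 1 ∧ A = Q * diagonal hA.eigenvalues * Qᵀ := by
  refine ⟨hA.eigenvectorUnitary, ?_, ?_⟩
  · have := Unitary.coe_star_mul_self hA.eigenvectorUnitary
    rwa [star_eq_conjTranspose, conjTranspose_eq_transpose_of_trivial] at this
  · have := hA.spectral_theorem
    rwa [Unitary.conjStarAlgAut_apply, star_eq_conjTranspose,
      conjTranspose_eq_transpose_of_trivial] at this

-- Applied to a diagonal B, this diagonalizes A with its eigenvalues in any prescribed order.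
open Matrix in
theorem exists_orthogonal_conj_of_charpoly_eq {n : ℕ} {A B : Matrix (Fin n) (Fin n) ℝ}
    (hA : A.IsHermitian) (hB : B.IsHermitian) (h : A.charpoly = B.charpoly) :
    ∃ Q : Matrix (Fin n) (Fin n) ℝ, Qᵀ * Q = 1 ∧ A = Q * B * Qᵀ := by
  obtain ⟨U, hU, hAU⟩ := exists_orthogonal_diagonalization hA
  obtain ⟨V, hV, hBV⟩ := exists_orthogonal_diagonalization hB
  rw [(IsHermitian.eigenvalues_eq_eigenvalues_iff hA hB).2 h] at hAU
  refine ⟨U * Vᵀ, ?_, ?_⟩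
  · rw [transpose_mul, transpose_transpose, Matrix.mul_assoc, ← Matrix.mul_assoc Uᵀ, hU,
      Matrix.one_mul, mul_eq_one_comm.1 hV]
  · have : U * Vᵀ * B * (U * Vᵀ)ᵀ =
        U * ((Vᵀ * V) * diagonal hB.eigenvalues * (Vᵀ * V)) * Uᵀ := by
      nth_rw 1 [hBV]
      simp only [transpose_mul, transpose_transpose, Matrix.mul_assoc]
    rw [this, hV, Matrix.one_mul, Matrix.mul_one, ← hAU]

open Matrix in
theorem orthogonal_conj_mul_conj {n : ℕ} {Q : Matrix (Fin n) (Fin n) ℝ} (hQ : Qᵀ * Q = 1)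
    (A B : Matrix (Fin n) (Fin n) ℝ) : Q * A * Qᵀ * (Q * B * Qᵀ) = Q * (A * B) * Qᵀ := by
  calc Q * A * Qᵀ * (Q * B * Qᵀ) = Q * A * (Qᵀ * Q) * B * Qᵀ := by
        simp only [Matrix.mul_assoc]
    _ = _ := by rw [hQ]; simp only [Matrix.mul_assoc, Matrix.one_mul]

open Matrix in
theorem charpoly_orthogonal_conj {n : ℕ} {Q : Matrix (Fin n) (Fin n) ℝ} (hQ : Qᵀ * Q = 1)
    (A : Matrix (Fin n) (Fin n) ℝ) : (Q * A * Qᵀ).charpoly = A.charpoly := by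
  rw [charpoly_mul_comm, ← Matrix.mul_assoc, hQ, Matrix.one_mul]

-- Expressed through the characteristic polynomial, the nuclear norm is visibly invariant under
-- orthogonal conjugation, whatever the enumeration of the eigenvalues.
open Matrix in
theorem nuclearNorm_eq_sum_roots {n : ℕ} (A : Matrix (Fin n) (Fin n) ℝ) :
    nuclearNorm A = ((Aᵀ * A).charpoly.roots.map Real.sqrt).sum := by
  have h := (isHermitian_conjTranspose_mul_self A).roots_charpoly_eq_eigenvalues
  rw [← conjTranspose_eq_transpose_of_trivial A, h, Multiset.map_map]
  rfl

open Matrix in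
theorem nuclearNorm_orthogonal_conj {n : ℕ} {Q : Matrix (Fin n) (Fin n) ℝ} (hQ : Qᵀ * Q = 1)
    (A : Matrix (Fin n) (Fin n) ℝ) : nuclearNorm (Q * A * Qᵀ) = nuclearNorm A := by
  have h : (Q * A * Qᵀ)ᵀ = Q * Aᵀ * Qᵀ := by
    simp only [transpose_mul, transpose_transpose, Matrix.mul_assoc]
  rw [nuclearNorm_eq_sum_roots, nuclearNorm_eq_sum_roots, h, orthogonal_conj_mul_conj hQ,
    charpoly_orthogonal_conj hQ]

open Matrix in
theorem nuclearNorm_diagonal {n : ℕ} {d : Fin n → ℝ} (hd : ∀ i, 0 ≤ d i) :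
    nuclearNorm (diagonal d) = ∑ i, d i := by
  rw [nuclearNorm_eq_sum_roots, diagonal_transpose, diagonal_mul_diagonal, charpoly_diagonal,
    Polynomial.roots_prod _ _ (Finset.prod_ne_zero_iff.2 fun i _ => Polynomial.X_sub_C_ne_zero _)]
  simp only [Polynomial.roots_X_sub_C, Multiset.bind_singleton, Multiset.map_map,
    Function.comp_apply, Real.sqrt_mul_self (hd _)]
  rfl

open Matrix in
theorem nuclearNorm_eq_trace_of_posSemidef {n : ℕ} {A : Matrix (Fin n) (Fin n) ℝ}
    (hA : A.PosSemidef) : nuclearNorm A = A.trace := by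
  obtain ⟨Q, hQ, h⟩ := exists_orthogonal_diagonalization hA.1
  have := hA.1.trace_eq_sum_eigenvalues
  rw [this]
  nth_rw 1 [h]
  rw [nuclearNorm_orthogonal_conj hQ, nuclearNorm_diagonal hA.eigenvalues_nonneg]
  rfl

open Matrix in
open scoped Matrix.Norms.L2Operator in
theorem spectralNorm2_eq_norm {n : ℕ} (A : Matrix (Fin n) (Fin n) ℝ) : spectralNorm2 A = ‖A‖ :=
  rfl

open Matrix in
open scoped Matrix.Norms.L2Operator in
theorem spectralNorm2_orthogonal_conj {n : ℕ} {Q : Matrix (Fin n) (Fin n) ℝ} (hQ : Qᵀ * Q = 1)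
    (A : Matrix (Fin n) (Fin n) ℝ) : spectralNorm2 (Q * A * Qᵀ) = spectralNorm2 A := by
  have hu : Q ∈ unitary (Matrix (Fin n) (Fin n) ℝ) := by
    rw [Unitary.mem_iff, star_eq_conjTranspose, conjTranspose_eq_transpose_of_trivial]
    exact ⟨hQ, mul_eq_one_comm.1 hQ⟩
  have hu' : Qᵀ ∈ unitary (Matrix (Fin n) (Fin n) ℝ) := by
    have := Unitary.star_mem hu
    rwa [star_eq_conjTranspose, conjTranspose_eq_transpose_of_trivial] at this
  rw [spectralNorm2_eq_norm, CStarRing.norm_mul_mem_unitary _ hu',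
    CStarRing.norm_mem_unitary_mul _ hu, spectralNorm2_eq_norm]

open Matrix in
open scoped Matrix.Norms.L2Operator in
theorem spectralNorm2_diagonal {n : ℕ} (d : Fin n → ℝ) :
    spectralNorm2 (diagonal d) = ‖d‖ := by
  rw [spectralNorm2_eq_norm, l2_opNorm_diagonal]

theorem pi_norm_eq_of_le {n : ℕ} {d : Fin n → ℝ} (i₀ : Fin n) (hd : ∀ i, 0 ≤ d i)
    (h : ∀ i, d i ≤ d i₀) : ‖d‖ = d i₀ := by
  apply le_antisymm
  · refine (pi_norm_le_iff_of_nonneg (hd i₀)).2 fun i => ?_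
    rw [Real.norm_of_nonneg (hd i)]
    exact h i
  · have := norm_le_pi_norm d i₀
    rwa [Real.norm_of_nonneg (hd i₀)] at this

open Matrix in
theorem effRank_orthogonal_conj_diagonal {n : ℕ} {Q : Matrix (Fin n) (Fin n) ℝ}
    (hQ : Qᵀ * Q = 1) {d : Fin n → ℝ} (i₀ : Fin n) (hd : ∀ i, 0 ≤ d i)
    (h : ∀ i, d i ≤ d i₀) : effRank (Q * diagonal d * Qᵀ) = (∑ i, d i) / d i₀ := by
  rw [effRank, nuclearNorm_orthogonal_conj hQ, spectralNorm2_orthogonal_conj hQ,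
    nuclearNorm_diagonal hd, spectralNorm2_diagonal, pi_norm_eq_of_le i₀ hd h]

/-! ### Best approximations in Frobenius norm. -/

open Matrix in
theorem frobSq_eq_trace {n : ℕ} (A : Matrix (Fin n) (Fin n) ℝ) : frobSq A = (Aᵀ * A).trace := by
  simp only [frobSq, trace, diag_apply, mul_apply, transpose_apply]
  rw [Finset.sum_comm]
  simp only [sq]

theorem eq_zero_of_frobSq_nonpos {n : ℕ} {A : Matrix (Fin n) (Fin n) ℝ} (h : frobSq A ≤ 0) :
    A = 0 := by
  ext i j
  have h1 : A i j ^ 2 ≤ frobSq A :=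
    (Finset.single_le_sum (f := fun j => A i j ^ 2) (fun _ _ => sq_nonneg _)
      (Finset.mem_univ j)).trans
      (Finset.single_le_sum (f := fun i => ∑ j, A i j ^ 2)
        (fun _ _ => Finset.sum_nonneg fun _ _ => sq_nonneg _) (Finset.mem_univ i))
  simpa using pow_eq_zero_iff two_ne_zero |>.1 (le_antisymm (h1.trans h) (sq_nonneg _))

open Matrix in
theorem frobSq_transpose {n : ℕ} (A : Matrix (Fin n) (Fin n) ℝ) : frobSq Aᵀ = frobSq A := by
  simp only [frobSq, transpose_apply]
  exact Finset.sum_comm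

open Matrix in
theorem frobSq_orthogonal_conj {n : ℕ} {Q : Matrix (Fin n) (Fin n) ℝ} (hQ : Qᵀ * Q = 1)
    (A : Matrix (Fin n) (Fin n) ℝ) : frobSq (Q * A * Qᵀ) = frobSq A := by
  have h : (Q * A * Qᵀ)ᵀ = Q * Aᵀ * Qᵀ := by
    simp only [transpose_mul, transpose_transpose, Matrix.mul_assoc]
  rw [frobSq_eq_trace, frobSq_eq_trace, h, orthogonal_conj_mul_conj hQ, trace_mul_comm,
    ← Matrix.mul_assoc, hQ, Matrix.one_mul]

open Matrix in
theorem IsBestRankApprox.transpose {n : ℕ} {A B : Matrix (Fin n) (Fin n) ℝ} {L : ℕ}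
    (h : IsBestRankApprox A L B) : IsBestRankApprox Aᵀ L Bᵀ := by
  refine ⟨by rw [rank_transpose]; exact h.1, fun C hC => ?_⟩
  have := h.2 Cᵀ (by rwa [rank_transpose])
  rwa [← frobSq_transpose, ← frobSq_transpose (A - Cᵀ), transpose_sub, transpose_sub,
    transpose_transpose] at this

open Matrix in
theorem IsBestRankApprox.of_orthogonal_conj {n : ℕ} {Q A B : Matrix (Fin n) (Fin n) ℝ} {L : ℕ}
    (hQ : Qᵀ * Q = 1) (h : IsBestRankApprox (Q * A * Qᵀ) L B) :
    IsBestRankApprox A L (Qᵀ * B * Q) := by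
  have hQ' := mul_eq_one_comm.1 hQ
  refine ⟨((rank_mul_le_left _ _).trans (rank_mul_le_right _ _)).trans h.1, fun C hC => ?_⟩
  have h1 := h.2 (Q * C * Qᵀ) (((rank_mul_le_left _ _).trans (rank_mul_le_right _ _)).trans hC)
  have h2 : B = Q * (Qᵀ * B * Q) * Qᵀ := by
    calc B = (Q * Qᵀ) * B * (Q * Qᵀ) := by rw [hQ', Matrix.one_mul, Matrix.mul_one]
      _ = _ := by simp only [Matrix.mul_assoc]
  rw [h2] at h1
  simpa only [← Matrix.mul_sub, ← Matrix.sub_mul, frobSq_orthogonal_conj hQ] using h1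

open Matrix in
/-- The orthogonal projection onto the column space of a matrix. -/
theorem exists_columnProjection {n : ℕ} (B : Matrix (Fin n) (Fin n) ℝ) :
    ∃ P : Matrix (Fin n) (Fin n) ℝ, Pᵀ = P ∧ P * P = P ∧ P * B = B ∧ P.trace = B.rank ∧
      P.rank ≤ B.rank ∧ spectralNorm2 P ≤ 1 := by
  classical
  have hH := isHermitian_mul_conjTranspose_self B
  obtain ⟨Q, hQ, h⟩ := exists_orthogonal_diagonalization hH
  set e : Fin n → ℝ := fun i => if hH.eigenvalues i ≠ 0 then 1 else 0 with he
  have hcard : B.rank = Fintype.card {i // hH.eigenvalues i ≠ 0} := by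
    rw [← hH.rank_eq_card_non_zero_eigs, rank_self_mul_conjTranspose]
  refine ⟨Q * diagonal e * Qᵀ, ?_, ?_, ?_, ?_, ?_, ?_⟩
  · simp only [transpose_mul, transpose_transpose, diagonal_transpose, Matrix.mul_assoc]
  · rw [orthogonal_conj_mul_conj hQ, diagonal_mul_diagonal]
    congr 3
    ext i
    simp [he]
  -- The projection fixes B Bᵀ by construction; (1 - P) B Bᵀ = 0 then forces (1 - P) B = 0.
  · have h1 : (1 - Q * diagonal e * Qᵀ) * (B * Bᴴ) = 0 := by
      rw [Matrix.sub_mul, Matrix.one_mul, sub_eq_zero]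
      refine h.trans (Eq.trans ?_ (congrArg (Q * diagonal e * Qᵀ * ·) h).symm)
      rw [orthogonal_conj_mul_conj hQ, diagonal_mul_diagonal]
      congr 3
      ext i
      simp only [he]
      split_ifs with hi
      · rw [one_mul]
      · rw [zero_mul, not_not.1 hi]
    rw [mul_self_mul_conjTranspose_eq_zero, Matrix.sub_mul, Matrix.one_mul, sub_eq_zero] at h1
    exact h1.symm
  · rw [trace_mul_comm, ← Matrix.mul_assoc, hQ, Matrix.one_mul, trace_diagonal, hcard, he,
      Finset.sum_boole, Fintype.card_subtype]
  · refine ((rank_mul_le_left _ _).trans (rank_mul_le_right _ _)).trans ?_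
    rw [rank_diagonal, hcard]
    refine le_of_eq (Fintype.card_congr (Equiv.subtypeEquivRight fun i => ?_))
    simp [he]
  · rw [spectralNorm2_orthogonal_conj hQ, spectralNorm2_diagonal]
    refine (pi_norm_le_iff_of_nonneg zero_le_one).2 fun i => ?_
    simp only [he]
    split_ifs <;> simp

-- P A is itself a competitor, and A - B splits orthogonally into (P A - B) + (A - P A), so
-- optimality leaves no room for the first part.
open Matrix in
theorem IsBestRankApprox.eq_projection_mul {n : ℕ} {A B P : Matrix (Fin n) (Fin n) ℝ} {L : ℕ}
    (h : IsBestRankApprox A L B) (hP : Pᵀ = P) (hPP : P * P = P) (hPB : P * B = B)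
    (hr : P.rank ≤ B.rank) : B = P * A := by
  have h1 := h.2 (P * A) (((rank_mul_le_left _ _).trans hr).trans h.1)
  have h2 : frobSq (A - B) = frobSq (P * A - B) + frobSq (A - P * A) := by
    have e : A - B = (P * A - B) + (A - P * A) := by abel
    have e1 : (P * A - B)ᵀ * (A - P * A) = 0 := by
      have : P * A - B = P * (P * A - B) := by
        rw [Matrix.mul_sub, ← Matrix.mul_assoc, hPP, hPB]
      rw [this, transpose_mul, hP, Matrix.mul_assoc, Matrix.mul_sub, ← Matrix.mul_assoc P P, hPP,
        sub_self, Matrix.mul_zero]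
    have e2 : (A - P * A)ᵀ * (P * A - B) = 0 := by
      rw [← transpose_inj, transpose_mul, transpose_transpose, e1, transpose_zero]
    rw [frobSq_eq_trace, e, transpose_add, Matrix.add_mul, Matrix.mul_add, Matrix.mul_add, e1, e2,
      add_zero, zero_add, trace_add, ← frobSq_eq_trace, ← frobSq_eq_trace]
  have h3 := eq_zero_of_frobSq_nonpos (A := P * A - B) (by linarith)
  exact (sub_eq_zero.1 h3).symm

open Matrix in
theorem effRank_orthogonal_conj {n : ℕ} {Q : Matrix (Fin n) (Fin n) ℝ} (hQ : Qᵀ * Q = 1)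
    (A : Matrix (Fin n) (Fin n) ℝ) : effRank (Q * A * Qᵀ) = effRank A := by
  rw [effRank, effRank, nuclearNorm_orthogonal_conj hQ, spectralNorm2_orthogonal_conj hQ]

theorem sum_fin_ite_lt {n L : ℕ} (hLn : L ≤ n) :
    ∑ i : Fin n, (if (i : ℕ) < L then (1 : ℝ) else 0) = L := by
  rw [Fin.sum_univ_eq_sum_range (fun i => if i < L then (1 : ℝ) else 0) n, Finset.sum_boole]
  have : (Finset.range n).filter (fun i => i < L) = Finset.range L := by
    ext i; simp; omega
  rw [this, Finset.card_range]

/-- If weights `p ∈ [0, 1]` of total mass at most `L` capture as much of the squares of an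
antitone sequence as its first `L` terms, the mass sits on a set of `L` largest values. -/
theorem mul_sub_eq_zero_of_captures_squares {n L : ℕ} {a p : Fin n → ℝ} (ha : Antitone a)
    (ha0 : ∀ i, 0 ≤ a i) (hL : 1 ≤ L) (hLn : L ≤ n) {m : ℝ} (hm : m = a ⟨L - 1, by omega⟩)
    (hm0 : 0 < m)
    (hp0 : ∀ i, 0 ≤ p i) (hp1 : ∀ i, p i ≤ 1) (hpL : ∑ i, p i ≤ L)
    (h : ∑ i, a i ^ 2 * ((if (i : ℕ) < L then 1 else 0) - p i) ≤ 0) :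
    (∀ i, (a i - m) * ((if (i : ℕ) < L then 1 else 0) - p i) = 0) ∧ ∑ i, p i = L := by
  set c : Fin n → ℝ := fun i => if (i : ℕ) < L then 1 else 0 with hc
  have hcsum : ∑ i, c i = L := sum_fin_ite_lt hLn
  -- The level m² separates the first L squares from the rest, so each excess over m² carries the
  -- sign of its weight difference.
  have hterm : ∀ i, 0 ≤ (a i ^ 2 - m ^ 2) * (c i - p i) := by
    intro i
    by_cases hi : (i : ℕ) < L
    · have h1 : m ≤ a i := hm ▸ ha (Fin.mk_le_mk.2 (by omega) : i ≤ ⟨L - 1, by omega⟩)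
      have h2 : c i = 1 := if_pos hi
      rw [h2]
      exact mul_nonneg (sub_nonneg.2 (pow_le_pow_left₀ hm0.le h1 2)) (sub_nonneg.2 (hp1 i))
    · have h1 : a i ≤ m := hm ▸ ha (Fin.mk_le_mk.2 (by omega) : ⟨L - 1, by omega⟩ ≤ i)
      have h2 : c i = 0 := if_neg hi
      rw [h2]
      exact mul_nonneg_of_nonpos_of_nonpos
        (sub_nonpos.2 (pow_le_pow_left₀ (ha0 i) h1 2)) (by linarith [hp0 i])
  have hsum : ∑ i, (a i ^ 2 - m ^ 2) * (c i - p i) =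
      ∑ i, a i ^ 2 * (c i - p i) - m ^ 2 * (L - ∑ i, p i) := by
    rw [← hcsum, ← Finset.sum_sub_distrib, Finset.mul_sum, ← Finset.sum_sub_distrib]
    exact Finset.sum_congr rfl fun i _ => by ring
  have hS : 0 ≤ ∑ i, (a i ^ 2 - m ^ 2) * (c i - p i) := Finset.sum_nonneg fun i _ => hterm i
  have hm2 : 0 < m ^ 2 := by positivity
  -- A nonnegative sum equals a nonpositive one minus m²(L - ∑ p), so all of these vanish.
  have hLp : ∑ i, p i = L := by nlinarith
  refine ⟨fun i => ?_, hLp⟩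
  have h0 : ∑ i, (a i ^ 2 - m ^ 2) * (c i - p i) = 0 := by
    refine le_antisymm ?_ hS
    rw [hsum, hLp]
    simpa using h
  have h1 := (Finset.sum_eq_zero_iff_of_nonneg fun i _ => hterm i).1 h0 i (Finset.mem_univ i)
  have h2 : (a i + m) * ((a i - m) * (c i - p i)) = 0 := by rw [← h1]; ring
  exact (mul_eq_zero.1 h2).resolve_left (by linarith [ha0 i])

open Matrix in
theorem frobSq_diagonal_sub_projection_mul {n : ℕ} {P : Matrix (Fin n) (Fin n) ℝ} (hP : Pᵀ = P)
    (hPP : P * P = P) (a : Fin n → ℝ) :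
    frobSq (diagonal a - P * diagonal a) = ∑ i, a i ^ 2 * (1 - P i i) := by
  have h1 : diagonal a - P * diagonal a = (1 - P) * diagonal a := by
    rw [Matrix.sub_mul, Matrix.one_mul]
  have h2 : (1 - P) * (1 - P) = 1 - P := by
    rw [Matrix.mul_sub, Matrix.mul_one, Matrix.sub_mul, hPP, Matrix.one_mul, sub_self, sub_zero]
  rw [h1, frobSq_eq_trace, transpose_mul, transpose_sub, transpose_one, hP, diagonal_transpose,
    Matrix.mul_assoc, ← Matrix.mul_assoc (1 - P), h2, trace]
  refine Finset.sum_congr rfl fun i _ => ?_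
  rw [diag_apply, diagonal_mul, mul_diagonal, Matrix.sub_apply, one_apply_eq]
  ring

open Matrix in
theorem projection_diag_mem_Icc {n : ℕ} {P : Matrix (Fin n) (Fin n) ℝ} (hP : Pᵀ = P)
    (hPP : P * P = P) (i : Fin n) : 0 ≤ P i i ∧ P i i ≤ 1 := by
  have h1 : P i i ^ 2 ≤ P i i := by
    have h2 : P i i = ∑ j, P i j ^ 2 := by
      nth_rw 1 [← hPP]
      rw [mul_apply]
      refine Finset.sum_congr rfl fun j _ => ?_
      rw [sq, ← congrFun (congrFun hP i) j, transpose_apply]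
    nth_rw 2 [h2]
    exact Finset.single_le_sum (f := fun j => P i j ^ 2) (fun _ _ => sq_nonneg _)
      (Finset.mem_univ i)
  have h0 := (sq_nonneg (P i i)).trans h1
  exact ⟨h0, by nlinarith⟩

open Matrix in
open scoped Matrix.Norms.L2Operator in
theorem le_spectralNorm2_of_mul_eq_smul {n : ℕ} {B M : Matrix (Fin n) (Fin n) ℝ} {c : ℝ}
    (hM : M ≠ 0) (h : B * M = c • M) : c ≤ spectralNorm2 B := by
  rw [spectralNorm2_eq_norm]
  have h1 := norm_mul_le B M
  rw [h, norm_smul] at h1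
  exact (le_abs_self c).trans (le_of_mul_le_mul_right h1 (norm_pos_iff.2 hM))

open Matrix in
open scoped Matrix.Norms.L2Operator in
theorem spectralNorm2_mul_le {n : ℕ} (A B : Matrix (Fin n) (Fin n) ℝ) :
    spectralNorm2 (A * B) ≤ spectralNorm2 A * spectralNorm2 B := by
  simpa only [spectralNorm2_eq_norm] using norm_mul_le A B

open Matrix in
/-- A best approximation of a nonnegative diagonal matrix is its product with a commuting
orthogonal projection. -/
theorem IsBestRankApprox.exists_commuting_projection {n L : ℕ} {a : Fin n → ℝ}
    (ha0 : ∀ i, 0 ≤ a i) {B : Matrix (Fin n) (Fin n) ℝ}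
    (h : IsBestRankApprox (diagonal a) L B) :
    ∃ P : Matrix (Fin n) (Fin n) ℝ, Pᵀ = P ∧ P * P = P ∧ P.trace ≤ L ∧ spectralNorm2 P ≤ 1 ∧
      B = P * diagonal a ∧ P * diagonal a = diagonal a * P := by
  obtain ⟨P, hP, hPP, hPB, htr, hr, hnorm⟩ := exists_columnProjection B
  obtain ⟨R, hR, hRR, hRB, -, hr', -⟩ := exists_columnProjection Bᵀ
  have hB := h.eq_projection_mul hP hPP hPB hr
  have hB' := h.transpose.eq_projection_mul hR hRR hRB hr'
  rw [diagonal_transpose] at hB'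
  have hBR : B * R = B := by
    rw [← transpose_inj, transpose_mul, hR, hRB]
  -- The row projection R gives Bᵀ = R A and B R = B. Hence B Bᵀ = B A, that is, P A² P = P A²;
  -- transposing shows that P commutes with A².
  have hBBt : B * Bᵀ = B * diagonal a := by
    rw [hB', ← Matrix.mul_assoc, hBR]
  have hcomm : P * (diagonal a * diagonal a) = diagonal a * diagonal a * P := by
    have h1 : P * (diagonal a * diagonal a) * P = P * (diagonal a * diagonal a) := by
      have h2 : Bᵀ = diagonal a * P := by rw [hB, transpose_mul, hP, diagonal_transpose]
      rw [h2, hB] at hBBt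
      simpa only [Matrix.mul_assoc] using hBBt
    have h2 := congrArg (fun M : Matrix (Fin n) (Fin n) ℝ => Mᵀ) h1
    simp only [transpose_mul, hP, diagonal_transpose, ← Matrix.mul_assoc] at h1 h2 ⊢
    exact h1.symm.trans h2
  refine ⟨P, hP, hPP, ?_, hnorm, hB, ?_⟩
  · rw [htr]; exact_mod_cast h.1
  · ext i j
    have h1 := congrFun (congrFun hcomm i) j
    rw [diagonal_mul_diagonal, mul_diagonal, diagonal_mul] at h1
    rw [mul_diagonal, diagonal_mul]
    -- Commuting with A² means (a i² - a j²) P i j = 0; nonnegativity of a allows cancelling a i + a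
    -- j.
    rcases eq_or_ne (a i + a j) 0 with h0 | h0
    · have := ha0 i
      have := ha0 j
      rw [show a i = 0 by linarith, show a j = 0 by linarith, mul_zero, zero_mul]
    · refine mul_left_cancel₀ h0 ?_
      linear_combination h1

-- Repeated eigenvalues leave B undetermined, but its effective rank only sees the trace and the
-- largest eigenvalue. The diagonal of P gives weights to which
-- `mul_sub_eq_zero_of_captures_squares` applies.
open Matrix in
theorem IsBestRankApprox.effRank_eq_of_diagonal {n L : ℕ} {a : Fin n → ℝ} (ha : Antitone a)
    (ha0 : ∀ i, 0 ≤ a i) (hL : 1 ≤ L) (hLn : L ≤ n) (hpos : 0 < a ⟨L - 1, by omega⟩)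
    {B : Matrix (Fin n) (Fin n) ℝ} (h : IsBestRankApprox (diagonal a) L B) :
    effRank B = (∑ i : Fin n, if (i : ℕ) < L then a i else 0) / a ⟨0, by omega⟩ := by
  obtain ⟨P, hP, hPP, htr, hnorm, hB, hcomm⟩ := h.exists_commuting_projection ha0
  set m := a ⟨L - 1, by omega⟩ with hm
  set i₀ : Fin n := ⟨0, by omega⟩ with hi₀
  have hmax : ∀ i, a i ≤ a i₀ := fun i => ha (Fin.mk_le_mk.2 (Nat.zero_le _))
  have hcap : ∑ i, a i ^ 2 * ((if (i : ℕ) < L then 1 else 0) - P i i) ≤ 0 := by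
    have hrank : (diagonal fun i : Fin n => if (i : ℕ) < L then a i else 0).rank ≤ L := by
      classical
      rw [rank_diagonal, Fintype.card_subtype]
      have hsub : ((Finset.univ.filter fun i : Fin n =>
          (if (i : ℕ) < L then a i else 0) ≠ 0).map Fin.valEmbedding) ⊆ Finset.range L := by
        intro j hj
        simp only [Finset.mem_map, Finset.mem_filter, Finset.mem_univ, true_and] at hj
        obtain ⟨i, hi, rfl⟩ := hj
        by_contra hc
        rw [Finset.mem_range] at hc
        exact hi (if_neg hc)
      simpa using Finset.card_le_card hsub
    have h1 := h.2 _ hrank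
    rw [hB, frobSq_diagonal_sub_projection_mul hP hPP] at h1
    have h2 : frobSq (diagonal a - diagonal fun i : Fin n => if (i : ℕ) < L then a i else 0) =
        ∑ i : Fin n, a i ^ 2 * (1 - if (i : ℕ) < L then 1 else 0) := by
      rw [diagonal_sub, frobSq_eq_trace, diagonal_transpose, diagonal_mul_diagonal,
        trace_diagonal]
      refine Finset.sum_congr rfl fun i _ => ?_
      split_ifs <;> ring
    rw [h2, ← sub_nonpos, ← Finset.sum_sub_distrib] at h1
    refine le_trans (le_of_eq (Finset.sum_congr rfl fun i _ => ?_)) h1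
    ring
  obtain ⟨hz, hsum⟩ := mul_sub_eq_zero_of_captures_squares ha ha0 hL hLn hm hpos
    (fun i => (projection_diag_mem_Icc hP hPP i).1) (fun i => (projection_diag_mem_Icc hP hPP i).2)
    htr hcap
  have htrace : B.trace = ∑ i : Fin n, if (i : ℕ) < L then a i else 0 := by
    have hcsum := sum_fin_ite_lt hLn
    have h1 : ∑ i : Fin n, (a i - m) * ((if (i : ℕ) < L then 1 else 0) - P i i) = 0 :=
      Finset.sum_eq_zero fun i _ => hz i
    have h2 : ∑ i : Fin n, (a i - m) * ((if (i : ℕ) < L then 1 else 0) - P i i) =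
        (∑ i : Fin n, if (i : ℕ) < L then a i else 0) - B.trace -
          m * (∑ i : Fin n, (if (i : ℕ) < L then (1 : ℝ) else 0) - ∑ i, P i i) := by
      rw [hB, trace, ← Finset.sum_sub_distrib, ← Finset.sum_sub_distrib, Finset.mul_sum,
        ← Finset.sum_sub_distrib]
      refine Finset.sum_congr rfl fun i _ => ?_
      rw [diag_apply, mul_diagonal]
      split_ifs <;> ring
    rw [h1, hcsum, hsum] at h2
    linarith
  have hpsd : B.PosSemidef := by
    have h1 : B = P * diagonal a * Pᴴ := by
      rw [conjTranspose_eq_transpose_of_trivial, hP, Matrix.mul_assoc, ← hcomm,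
        ← Matrix.mul_assoc, hPP, hB]
    rw [h1]
    exact (PosSemidef.diagonal ha0).mul_mul_conjTranspose_same P
  have hsn : spectralNorm2 B = a i₀ := by
    apply le_antisymm
    · rw [hB]
      refine (spectralNorm2_mul_le _ _).trans ?_
      rw [spectralNorm2_diagonal, pi_norm_eq_of_le i₀ ha0 hmax]
      exact mul_le_of_le_one_left (ha0 i₀) hnorm
    -- Otherwise P i₀ i₀ = 0 forces m = a i₀, so all of the mass L ≥ 1 would have to sit on indices
    -- where a equals a i₀, and there P has no diagonal mass.
    · obtain ⟨i, hai, hpi⟩ : ∃ i, a i = a i₀ ∧ 0 < P i i := by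
        by_contra! hcon
        have hp0 : P i₀ i₀ = 0 :=
          le_antisymm (hcon i₀ rfl) (projection_diag_mem_Icc hP hPP i₀).1
        have h1 := hz i₀
        rw [hp0, if_pos (show 0 < L by omega), sub_zero, mul_one, sub_eq_zero] at h1
        have h2 : ∑ i, P i i ≤ 0 := by
          refine Finset.sum_nonpos fun i _ => ?_
          by_cases hi : a i = a i₀
          · exact hcon i hi
          · have h3 := (mul_eq_zero.1 (hz i)).resolve_left (by rwa [sub_eq_zero, ← h1])
            have h4 : ¬ (i : ℕ) < L := fun h4 => hi (le_antisymm (hmax i)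
              (h1 ▸ ha (Fin.mk_le_mk.2 (by omega) : i ≤ ⟨L - 1, by omega⟩)))
            rw [if_neg h4] at h3
            linarith
        rw [hsum] at h2
        have : (1 : ℝ) ≤ L := by exact_mod_cast hL
        linarith
      -- The i-th column of P is an eigenvector of B for a i₀, nonzero because its i-th entry is
      -- positive.
      refine le_spectralNorm2_of_mul_eq_smul (M := P * single i i 1) ?_ ?_
      · intro h0
        have := congrFun (congrFun h0 i) i
        simp at this
        exact hpi.ne' this
      · rw [hB, hcomm, Matrix.mul_assoc, ← Matrix.mul_assoc P P, hPP, ← Matrix.mul_assoc, ← hcomm,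
          Matrix.mul_assoc, ← mul_smul_comm, ← hai]
        congr 1
        ext r s
        by_cases hr : r = i
        · subst hr; simp [diagonal_mul]
        · simp [diagonal_mul, Ne.symm hr]
  rw [effRank, nuclearNorm_eq_trace_of_posSemidef hpsd, htrace, hsn]

/-! ### The gradient and the diagonal form of the iterates. -/

open Matrix in
theorem hasDerivAt_half_frobSq_line {n : ℕ} (M N : Matrix (Fin n) (Fin n) ℝ) :
    HasDerivAt (fun t : ℝ => 1 / 2 * frobSq (M + t • N)) (∑ a, ∑ b, M a b * N a b) 0 := by
  have h : ∀ a b : Fin n,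
      HasDerivAt (fun t : ℝ => 1 / 2 * (M + t • N) a b ^ 2) (M a b * N a b) 0 := by
    intro a b
    have h1 : HasDerivAt (fun t : ℝ => M a b + t * N a b) (N a b) 0 := by
      simpa using ((hasDerivAt_id (0 : ℝ)).mul_const (N a b)).const_add (M a b)
    have h2 := (h1.pow 2).const_mul (1 / 2 : ℝ)
    refine h2.congr_deriv ?_
    simp
    ring
  have h3 := HasDerivAt.fun_sum (u := Finset.univ) fun a _ =>
    HasDerivAt.fun_sum (u := Finset.univ) fun b _ => h a b
  simpa only [frobSq, Finset.mul_sum] using h3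

open Matrix in
theorem matGrad_factLoss_left {n : ℕ} (What X Y : Matrix (Fin n) (Fin n) ℝ) :
    matGrad (fun X => factLoss What X Y) X = Yᵀ * (Y * X - What) := by
  ext i j
  have h : (fun t : ℝ => factLoss What (X + t • single i j (1 : ℝ)) Y) = fun t : ℝ =>
      1 / 2 * frobSq ((Y * X - What) + t • (Y * single i j (1 : ℝ))) := by
    funext t
    rw [factLoss, Matrix.mul_add, mul_smul_comm, add_sub_right_comm]
  simp only [matGrad, of_apply]
  rw [h, (hasDerivAt_half_frobSq_line _ _).deriv, mul_apply]
  refine Finset.sum_congr rfl fun a _ => ?_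
  rw [Finset.sum_eq_single j]
  · simp [mul_comm]
  · intro b _ hb
    rw [mul_single_apply_of_ne _ _ _ _ _ hb, mul_zero]
  · simp

open Matrix in
theorem matGrad_factLoss_right {n : ℕ} (What X Y : Matrix (Fin n) (Fin n) ℝ) :
    matGrad (fun Y => factLoss What X Y) Y = (Y * X - What) * Xᵀ := by
  ext i j
  have h : (fun t : ℝ => factLoss What X (Y + t • single i j (1 : ℝ))) = fun t : ℝ =>
      1 / 2 * frobSq ((Y * X - What) + t • (single i j (1 : ℝ) * X)) := by
    funext t
    rw [factLoss, Matrix.add_mul, smul_mul_assoc, add_sub_right_comm]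
  simp only [matGrad, of_apply]
  rw [h, (hasDerivAt_half_frobSq_line _ _).deriv, mul_apply, Finset.sum_eq_single i]
  · simp
  · intro a _ ha
    refine Finset.sum_eq_zero fun b _ => ?_
    rw [single_mul_apply_of_ne _ _ _ _ _ ha, mul_zero]
  · simp

open Matrix in
/-- Both gradient descent factors are diagonalized by the eigenbasis of the target. -/
theorem IsGradientDescent.eq_conj_diagonal {n : ℕ} {Q : Matrix (Fin n) (Fin n) ℝ}
    (hQ : Qᵀ * Q = 1) {a : Fin n → ℝ} {α η : ℝ} {W₁ W₂ : ℕ → Matrix (Fin n) (Fin n) ℝ}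
    (h : IsGradientDescent (Q * diagonal a * Qᵀ) α η W₁ W₂) (k : ℕ) :
    W₁ k = Q * diagonal (fun i => factorIter α η (a i) k) * Qᵀ ∧
      W₂ k = Q * diagonal (fun i => factorIter α η (a i) k) * Qᵀ := by
  induction k with
  | zero =>
    have h0 : Q * diagonal (fun i => factorIter α η (a i) 0) * Qᵀ =
        α • (1 : Matrix (Fin n) (Fin n) ℝ) := by
      have : diagonal (fun i => factorIter α η (a i) 0) =
          α • (1 : Matrix (Fin n) (Fin n) ℝ) := by
        rw [smul_one_eq_diagonal]; rfl
      rw [this, mul_smul_comm, Matrix.mul_one, smul_mul_assoc, mul_eq_one_comm.1 hQ]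
    rw [h0]
    exact ⟨h.1, h.2.1⟩
  | succ k ih =>
    obtain ⟨h1, h2⟩ := h.2.2 k
    rw [matGrad_factLoss_left] at h1
    rw [matGrad_factLoss_right] at h2
    rw [ih.1, ih.2] at h1 h2
    have ht : (Q * diagonal (fun i => factorIter α η (a i) k) * Qᵀ)ᵀ =
        Q * diagonal (fun i => factorIter α η (a i) k) * Qᵀ := by
      simp only [transpose_mul, transpose_transpose, diagonal_transpose, Matrix.mul_assoc]
    rw [ht, orthogonal_conj_mul_conj hQ, ← Matrix.sub_mul, ← Matrix.mul_sub,
      orthogonal_conj_mul_conj hQ, ← smul_mul_assoc, ← mul_smul_comm, ← Matrix.sub_mul,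
      ← Matrix.mul_sub] at h1 h2
    rw [h1, h2, diagonal_mul_diagonal, diagonal_sub, diagonal_mul_diagonal, diagonal_mul_diagonal,
      ← diagonal_smul, ← diagonal_smul, diagonal_sub, diagonal_sub]
    constructor <;> congr 3 <;> ext i <;> simp only [Pi.smul_apply, smul_eq_mul, factorIter_succ] <;>
      ring

open Matrix in
theorem IsOrderedSpectrum.exists_diagonalization {n : ℕ} {A : Matrix (Fin n) (Fin n) ℝ}
    {lam : ℕ → ℝ} (h : IsOrderedSpectrum A lam) (hA : A.IsSymm) :
    ∃ Q : Matrix (Fin n) (Fin n) ℝ, Qᵀ * Q = 1 ∧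
      A = Q * diagonal (fun i : Fin n => lam (i + 1)) * Qᵀ := by
  refine exists_orthogonal_conj_of_charpoly_eq ?_ ?_ ?_
  · rw [IsHermitian, conjTranspose_eq_transpose_of_trivial]; exact hA
  · rw [IsHermitian, conjTranspose_eq_transpose_of_trivial, diagonal_transpose]
  · rw [h.2, charpoly_diagonal,
      Fin.prod_univ_eq_prod_range (fun i => Polynomial.X - Polynomial.C (lam (i + 1))) n,
      Finset.range_eq_Ico,
      Finset.prod_Ico_add' (fun i => Polynomial.X - Polynomial.C (lam i)) 0 n 1]
    refine Finset.prod_congr ?_ fun _ _ => rfl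
    ext i
    simp only [Finset.mem_Icc, Finset.mem_Ico]
    omega

/-! ### Monotonicity of T₂ in the eigenvalue and comparison with T₁. -/

theorem abs_log_one_sub_sqrt_third_le : |Real.log (1 - √(1 / 3))| ≤ Real.log 4 := by
  have h : √(1 / 3 : ℝ) ≤ 3 / 4 := by
    rw [Real.sqrt_le_left (by norm_num)]; norm_num
  have h0 : 0 ≤ √(1 / 3 : ℝ) := Real.sqrt_nonneg _
  rw [abs_of_nonpos (Real.log_nonpos (by linarith) (by linarith)), ← Real.log_inv]
  refine Real.log_le_log (by rw [inv_pos]; linarith) ?_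
  rw [inv_le_comm₀ (by linarith) (by norm_num)]
  linarith

theorem constK_pos {ε : ℝ} (hε0 : 0 < ε) (hε1 : ε < 1) : 0 < constK ε := by
  have h1 : Real.log 4 < Real.log (8 / ε) := by
    refine Real.log_lt_log (by norm_num) ?_
    rw [lt_div_iff₀ hε0]; linarith
  have := abs_log_one_sub_sqrt_third_le
  rw [constK]; linarith

theorem sqrt_div_relative_tolerance {l ε : ℝ} (hl : 0 < l) (hε : 0 < ε) :
    √l / (√l / 8 * ε) = 8 / ε := by
  have : √l ≠ 0 := (Real.sqrt_pos.2 hl).ne'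
  field_simp

theorem timeT2_relative_tolerance {l ε : ℝ} (hl : 0 < l) (hε : 0 < ε) (α η : ℝ) :
    timeT2 l (√l / 8 * ε) α η = 1 / (2 * η * l) * (Real.log (l / α ^ 2 - 1) - Real.log 2)
      + (⌈√(l / 3) * (1 / α)⌉ : ℝ) + constK ε / |Real.log (1 - 2 * η * l / 3)| := by
  rw [timeT2, sqrt_div_relative_tolerance hl hε, constK]

/-- `s ↦ log ((s - 1) / 2) / s` is antitone on `[2 (e + 1), ∞)`. -/
theorem log_half_sub_one_div_antitoneOn :
    AntitoneOn (fun s : ℝ => (Real.log (s - 1) - Real.log 2) / s)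
      (Set.Ici (2 * (Real.exp 1 + 1))) := by
  intro s hs t _ hst
  rw [Set.mem_Ici] at hs
  have he := Real.exp_pos 1
  have hs0 : 0 < s := by linarith
  have ht0 : 0 < t := hs0.trans_le hst
  have hs1 : 0 < s - 1 := by linarith
  -- This says that the derivative is nonpositive. Splitting off log e = 1 and using log z ≥ 1 - 1/z
  -- reduces it to s ≥ 2(e + 1), the source of that constant.
  have hls : s / (s - 1) ≤ Real.log (s - 1) - Real.log 2 := by
    rw [← Real.log_div hs1.ne' two_ne_zero]
    have h1 : Real.log ((s - 1) / 2) = 1 + Real.log ((s - 1) / (2 * Real.exp 1)) := by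
      rw [show (s - 1) / 2 = Real.exp 1 * ((s - 1) / (2 * Real.exp 1)) by field_simp,
        Real.log_mul he.ne' (by positivity), Real.log_exp]
    have h2 := Real.one_sub_inv_le_log_of_pos (x := (s - 1) / (2 * Real.exp 1)) (by positivity)
    rw [h1]
    refine le_trans ?_ (add_le_add_right h2 1)
    have h3 : 1 + (1 - ((s - 1) / (2 * Real.exp 1))⁻¹) =
        (2 * (s - 1) - 2 * Real.exp 1) / (s - 1) := by
      field_simp
      ring
    rw [h3]
    gcongr
    linarith
  have hlt : Real.log (t - 1) ≤ Real.log (s - 1) + (t - s) / (s - 1) := by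
    have h1 := Real.log_le_sub_one_of_pos (x := (t - 1) / (s - 1))
      (div_pos (by linarith) hs1)
    rw [Real.log_div (by linarith) hs1.ne'] at h1
    have h2 : (t - 1) / (s - 1) - 1 = (t - s) / (s - 1) := by field_simp; ring
    linarith
  change _ / t ≤ _ / s
  rw [div_le_div_iff₀ ht0 hs0]
  have h1 : s * ((t - s) / (s - 1)) = (t - s) * (s / (s - 1)) := by ring
  have h2 := mul_le_mul_of_nonneg_left hls (sub_nonneg.2 hst)
  have h3 := mul_le_mul_of_nonneg_left hlt hs0.le
  nlinarith

theorem escapeTime_anti {α η x y : ℝ} (hα : 0 < α) (hη : 0 < η)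
    (hx : 2 * (Real.exp 1 + 1) * α ^ 2 ≤ x) (hxy : x ≤ y) :
    1 / (2 * η * y) * (Real.log (y / α ^ 2 - 1) - Real.log 2) ≤
      1 / (2 * η * x) * (Real.log (x / α ^ 2 - 1) - Real.log 2) := by
  have hα2 : 0 < α ^ 2 := by positivity
  have hx0 : 0 < x := lt_of_lt_of_le (by positivity) hx
  have hy0 : 0 < y := hx0.trans_le hxy
  have hxs : 2 * (Real.exp 1 + 1) ≤ x / α ^ 2 := by rwa [le_div_iff₀ hα2]
  have hst : x / α ^ 2 ≤ y / α ^ 2 := by gcongr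
  have h : (Real.log (y / α ^ 2 - 1) - Real.log 2) / (y / α ^ 2) ≤
      (Real.log (x / α ^ 2 - 1) - Real.log 2) / (x / α ^ 2) :=
    log_half_sub_one_div_antitoneOn hxs (hxs.trans hst) hst
  have e : ∀ z : ℝ, 0 < z → 1 / (2 * η * z) * (Real.log (z / α ^ 2 - 1) - Real.log 2) =
      1 / (2 * η * α ^ 2) * ((Real.log (z / α ^ 2 - 1) - Real.log 2) / (z / α ^ 2)) := by
    intro z hz
    field_simp
  rw [e x hx0, e y hy0]
  gcongr

/-- The contraction time decays in the eigenvalue at least at the rate `decayRate`. -/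
theorem decayRate_mul_le {ε η x y : ℝ} (hK : 0 < constK ε) (hη : 0 < η) (hx : 0 < x)
    (hxy : x ≤ y) (hy : η * y ≤ 1 / 4) :
    0 < decayRate ε η x y ∧ decayRate ε η x y * (y - x) ≤
      constK ε / |Real.log (1 - 2 * η * x / 3)| - constK ε / |Real.log (1 - 2 * η * y / 3)| := by
  have hηx : 0 < η * x := by positivity
  have hηxy : η * x ≤ η * y := by gcongr
  set p := 1 - 2 * η * x / 3 with hp
  set q := 1 - 2 * η * y / 3 with hq
  have hp' : 1 - 2 / 3 * η * x = p := by rw [hp]; ring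
  have hq' : 1 - 2 / 3 * η * y = q := by rw [hq]; ring
  have hq0 : 0 < q := by rw [hq]; linarith
  have hqp : q ≤ p := by rw [hp, hq]; linarith
  have hp0 : 0 < p := hq0.trans_le hqp
  have hlp : Real.log p < 0 := Real.log_neg hp0 (by rw [hp]; linarith)
  have hlq : Real.log q < 0 := Real.log_neg hq0 (by rw [hq]; linarith)
  have hlqp : Real.log q ≤ Real.log p := Real.log_le_log hq0 hqp
  rw [decayRate, hp', hq', abs_of_neg hlp, abs_of_neg hlq]
  have hden : 0 < 3 * p * Real.log q ^ 2 :=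
    mul_pos (by positivity) (pow_pos (neg_pos.2 hlq) 2 |>.trans_eq (by ring))
  refine ⟨div_pos (by positivity) hden, ?_⟩
  -- From log z ≥ 1 - 1/z at z = p/q. Then 1/A - 1/B = (B - A)/(AB) is bounded below by enlarging AB
  -- to B².
  have hdiff : (p - q) / p ≤ Real.log p - Real.log q := by
    have := Real.one_sub_inv_le_log_of_pos (x := p / q) (by positivity)
    rw [Real.log_div hp0.ne' hq0.ne'] at this
    refine le_trans (le_of_eq ?_) this
    field_simp
  have hpq : p - q = 2 / 3 * η * (y - x) := by rw [hp, hq]; ring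
  set A := -Real.log p with hA
  set B := -Real.log q with hB
  have hA0 : 0 < A := neg_pos.2 hlp
  have hAB : A ≤ B := neg_le_neg hlqp
  have hB0 : 0 < B := hA0.trans_le hAB
  have e1 : 2 * η * constK ε / (3 * p * Real.log q ^ 2) * (y - x) =
      constK ε * ((p - q) / p) / (B * B) := by
    rw [hpq, show Real.log q ^ 2 = B * B by rw [hB]; ring]
    field_simp
  have e2 : constK ε / A - constK ε / B = constK ε * (B - A) / (A * B) := by
    field_simp
  rw [e1, e2]
  have : (p - q) / p ≤ B - A := by rw [hA, hB]; linarith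
  have hBA : 0 ≤ B - A := sub_nonneg.2 hAB
  gcongr

/-- Of the three terms of T₂, only the ceiling grows with the eigenvalue; the gap condition says
that the gain in contraction time pays for it. -/
theorem timeT2_le_of_gap {ε α η x y : ℝ} (hε0 : 0 < ε) (hε1 : ε < 1) (hα : 0 < α) (hη : 0 < η)
    (hx : 2 * (Real.exp 1 + 1) * α ^ 2 ≤ x) (hxy : x ≤ y) (hy : η * y ≤ 1 / 4)
    (hgap : 1 / decayRate ε η x y *
      ((⌈√(y / 3) * (1 / α)⌉ : ℝ) - (⌈√(x / 3) * (1 / α)⌉ : ℝ)) ≤ y - x) :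
    timeT2 y (√y / 8 * ε) α η ≤ timeT2 x (√x / 8 * ε) α η := by
  have hx0 : 0 < x := lt_of_lt_of_le (by positivity) hx
  obtain ⟨hκ, h1⟩ := decayRate_mul_le (constK_pos hε0 hε1) hη hx0 hxy hy
  have h2 := escapeTime_anti hα hη hx hxy
  rw [one_div_mul_eq_div, div_le_iff₀ hκ] at hgap
  rw [timeT2_relative_tolerance hx0 hε0, timeT2_relative_tolerance (hx0.trans_le hxy) hε0]
  linarith

/-- By |log(1 - z)| ≥ z the contraction term is at most 3K_ε/(2ηy). After multiplication by 2η only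
the ceiling term still carries η, and solving for η gives η*. -/
theorem timeT2_lt_timeT1 {ε ε' α η x y : ℝ} (hK : 0 < constK ε) (hε0 : 0 < ε) (hα : 0 < α)
    (hη : 0 < η) (hy0 : 0 < y) (hy : η * y ≤ 1 / 4) (hηs : η < etaStar ε ε' α x y) :
    timeT2 y (√y / 8 * ε) α η < timeT1 x ε' α η := by
  have hηy : 0 < η * y := by positivity
  have hN : (0 : ℝ) < ⌈√(y / 3) * (1 / α)⌉ := by
    have : 0 < √(y / 3) * (1 / α) := by positivity
    exact_mod_cast Int.ceil_pos.2 this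
  rw [etaStar, lt_div_iff₀ (by positivity)] at hηs
  rw [timeT2_relative_tolerance hy0 hε0, timeT1]
  have hq0 : 0 < 1 - 2 * η * y / 3 := by linarith
  have hlog := Real.log_le_sub_one_of_pos hq0
  have hlq : 2 * η * y / 3 ≤ |Real.log (1 - 2 * η * y / 3)| := by
    rw [abs_of_neg (by linarith)]; linarith
  have h1 : constK ε / |Real.log (1 - 2 * η * y / 3)| ≤ constK ε / (2 * η * y / 3) := by
    gcongr
  have h2 : constK ε / (2 * η * y / 3) = 1 / (2 * η) * (1 / y * (3 * constK ε)) := by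
    field_simp
  set N : ℝ := (⌈√(y / 3) * (1 / α)⌉ : ℝ)
  have e : ∀ z w : ℝ, 1 / (2 * η * z) * w = 1 / (2 * η) * (1 / z * w) := by
    intro z w
    rw [← mul_assoc, one_div_mul_one_div]
  have h3 : N = 1 / (2 * η) * (η * (2 * N)) := by field_simp
  rw [e, e]
  have h4 := mul_lt_mul_of_pos_left hηs (by positivity : 0 < 1 / (2 * η))
  rw [← h3] at h4
  refine lt_of_le_of_lt (add_le_add_right (h1.trans_eq h2) _) ?_
  rw [mul_sub, mul_add (1 / y)] at h4
  linarith

/-! ### Assembling the effective rank bound. -/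

/-- Comparison of one ratio inside the leading block. -/
theorem abs_ratio_sub_ratio_le {x y D E ε : ℝ} (hE : 0 < E) (hx : 0 ≤ x) (hε0 : 0 < ε)
    (hε1 : ε < 1) (hy : (1 - ε / 4) * x ≤ y) (hyx : y ≤ x) (hD : (1 - ε / 4) * E ≤ D)
    (hDE : D ≤ E) : |x / E - y / D| ≤ ε * (x / E) := by
  have hD0 : 0 < D := lt_of_lt_of_le (mul_pos (by linarith) hE) hD
  rw [abs_le]
  constructor
  · have h1 : y / D ≤ (1 + ε) * (x / E) := by
      rw [← mul_div_assoc, div_le_div_iff₀ hD0 hE]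
      -- Here (1 + ε)(1 - ε/4) ≥ 1 because ε < 1.
      have h2 : E ≤ (1 + ε) * D := by nlinarith [mul_pos hε0 hE]
      calc y * E ≤ x * ((1 + ε) * D) := mul_le_mul hyx h2 hE.le hx
        _ = _ := by ring
    linarith
  · have h1 : (1 - ε) * (x / E) ≤ y / D := by
      rw [← mul_div_assoc, div_le_div_iff₀ hE hD0]
      have h2 : (1 - ε) * x ≤ y := by nlinarith
      exact mul_le_mul h2 hDE hD0.le (le_trans (mul_nonneg (by linarith) hx) hy)
    linarith

/-- Squaring doubles the relative error ε/8 to at most ε/4. -/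
theorem sq_ge_of_sqrt_sub_le {l d ε : ℝ} (hl : 0 < l) (hε0 : 0 < ε) (hε1 : ε < 1)
    (h : √l - d ≤ √l / 8 * ε) : (1 - ε / 4) * l ≤ d ^ 2 := by
  have hs : √l ^ 2 = l := Real.sq_sqrt hl.le
  have hs0 : 0 < √l := Real.sqrt_pos.2 hl
  have h1 : √l * (1 - ε / 8) ≤ d := by linarith
  have h2 : 0 ≤ √l * (1 - ε / 8) := mul_nonneg hs0.le (by linarith)
  have h3 := pow_le_pow_left₀ h2 h1 2
  rw [mul_pow, hs] at h3
  nlinarith [mul_nonneg hl.le (sq_nonneg ε)]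

theorem sum_fin_ite_ge {n m : ℕ} (hm : m ≤ n) (c : ℝ) :
    ∑ i : Fin n, (if m ≤ (i : ℕ) then c else 0) = ((n : ℝ) - m) * c := by
  have h : ∀ i : Fin n, (if m ≤ (i : ℕ) then c else 0) =
      c - c * (if (i : ℕ) < m then 1 else 0) := by
    intro i
    split_ifs <;> first | omega | ring
  simp only [h, Finset.sum_sub_distrib, ← Finset.mul_sum, sum_fin_ite_lt hm, Finset.sum_const,
    Finset.card_univ, Fintype.card_fin, nsmul_eq_mul]
  ring

open Matrix in
/-- The effective rank bound for a diagonalized target. -/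
theorem abs_effRank_sub_effRank_le {n : ℕ} {What : Matrix (Fin n) (Fin n) ℝ}
    (hsymm : What.IsSymm) {lam : ℕ → ℝ} (hspec : IsOrderedSpectrum What lam)
    (hnonneg : 0 ≤ lam n) {L : ℕ} (hL : 1 ≤ L) (hLn : L + 1 ≤ n) (hpos : 0 < lam (L + 1))
    {ε ε' α η : ℝ} (hε : ε ∈ Set.Ioo (0 : ℝ) 1) (hε' : ε' ∈ Set.Ioo (0 : ℝ) (1 / 3))
    (hα : 0 < α) (hαlam : α ^ 2 < ε' * lam (L + 1)) (hη : 0 < η) (hηlam : η * lam 1 ≤ 1 / 4)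
    {W₁ W₂ : ℕ → Matrix (Fin n) (Fin n) ℝ} (hGD : IsGradientDescent What α η W₁ W₂)
    {L' : ℕ} (hL' : IsGreatest {l : ℕ | l ∈ Finset.Icc 1 n ∧ α ^ 2 < ε' * lam l} L')
    {WL : Matrix (Fin n) (Fin n) ℝ} (hWL : IsBestRankApprox What L WL) {k : ℕ}
    (hk₀ : ∀ l ∈ Finset.Icc 1 L, timeT2 (lam l) (√(lam l) / 8 * ε) α η ≤ k)
    (hk₁ : (k : ℝ) ≤ timeT1 (lam (L + 1)) ε' α η) :
    |effRank WL - effRank (W₂ k * W₁ k)|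
      ≤ ε * effRank WL + 6 * ((L' : ℝ) - (L : ℝ)) * (lam (L + 1) / lam 1) * ε'
        + ((n : ℝ) - (L' : ℝ)) * (2 * α ^ 2 / (ε' * lam 1)) := by
  obtain ⟨hε0, hε1⟩ := hε
  obtain ⟨hε0', hε1'⟩ := hε'
  have hanti := hspec.1
  have hmono : ∀ {i j : ℕ}, 1 ≤ i → i ≤ j → j ≤ n → lam j ≤ lam i := fun h1 h2 h3 =>
    hanti ⟨h1, h2.trans h3⟩ ⟨h1.trans h2, h3⟩ h2
  have hn : 0 < n := by omega
  have hα2 : 0 < α ^ 2 := by positivity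
  have hE : 0 < lam 1 := hpos.trans_le (hmono le_rfl (by omega) hLn)
  have hL1 : lam (L + 1) ≤ lam 1 := hmono le_rfl (by omega) hLn
  have hηl : ∀ i, 1 ≤ i → i ≤ n → η * lam i ≤ 1 / 4 := fun i h1 h2 =>
    (mul_le_mul_of_nonneg_left (hmono le_rfl h1 h2) hη.le).trans hηlam
  have hηα : η * α ^ 2 ≤ 1 / 4 := by
    have : α ^ 2 ≤ lam 1 := by nlinarith
    exact (mul_le_mul_of_nonneg_left this hη.le).trans hηlam
  have hLL' : L + 1 ≤ L' := hL'.2 ⟨Finset.mem_Icc.2 ⟨by omega, hLn⟩, hαlam⟩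
  have hL'n : L' ≤ n := (Finset.mem_Icc.1 hL'.1.1).2
  obtain ⟨Q, hQ, hWhat⟩ := hspec.exists_diagonalization hsymm
  set a : Fin n → ℝ := fun i => lam (i + 1) with ha
  have ha_anti : Antitone a := fun i j hij =>
    hmono (by omega) (Nat.succ_le_succ hij) j.2
  have ha0 : ∀ i, 0 ≤ a i := fun i => hnonneg.trans (hmono (by omega) i.2 le_rfl)
  have hQt : Qᵀᵀ * Qᵀ = 1 := by rw [transpose_transpose, mul_eq_one_comm.1 hQ]
  have hrL : effRank WL = ∑ i : Fin n, (if (i : ℕ) < L then a i else 0) / lam 1 := by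
    rw [hWhat] at hWL
    have h1 := hWL.of_orthogonal_conj hQ
    have hLpos : 0 < a ⟨L - 1, by omega⟩ := by
      refine hpos.trans_le (hmono ?_ ?_ hLn)
      · simp
      · change L - 1 + 1 ≤ L + 1
        omega
    have h2 := h1.effRank_eq_of_diagonal ha_anti ha0 hL (by omega) hLpos
    have h3 := effRank_orthogonal_conj hQt WL
    rw [transpose_transpose] at h3
    rw [← h3, h2, Finset.sum_div]
  set d : Fin n → ℝ := fun i => factorIter α η (a i) k with hd
  set i₀ : Fin n := ⟨0, hn⟩ with hi₀
  have hd0 : ∀ i, 0 ≤ d i ∧ d i ^ 2 ≤ max (a i) (α ^ 2) := fun i =>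
    factorIter_nonneg_and_le_sup hα hη (ha0 i) (hηl _ (by omega) i.2) hηα k
  have hdmono : ∀ i j : Fin n, i ≤ j → d j ≤ d i := fun i j hij =>
    factorIter_mono hα hη (ha0 j) (ha_anti hij) (hηl _ (by omega) i.2) hηα k
  have hrW : effRank (W₂ k * W₁ k) = ∑ i : Fin n, d i ^ 2 / d i₀ ^ 2 := by
    rw [hWhat] at hGD
    obtain ⟨h1, h2⟩ := hGD.eq_conj_diagonal hQ k
    rw [h1, h2, orthogonal_conj_mul_conj hQ, diagonal_mul_diagonal,
      effRank_orthogonal_conj_diagonal hQ i₀ (fun i => mul_self_nonneg _)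
        (fun i => mul_self_le_mul_self (hd0 i).1 (hdmono i₀ i (Fin.mk_le_mk.2 (Nat.zero_le _)))),
      Finset.sum_div]
    simp only [sq]
  have hlead : ∀ i : Fin n, (i : ℕ) < L → (1 - ε / 4) * a i ≤ d i ^ 2 ∧ d i ^ 2 ≤ a i := by
    intro i hi
    have h1 : lam (L + 1) ≤ a i := hmono (by omega) (by omega) hLn
    have h3α : 3 * α ^ 2 < a i := by nlinarith
    have hai : 0 < a i := hpos.trans_le h1
    have hK : 0 ≤ Real.log (√(a i) / (√(a i) / 8 * ε)) - |Real.log (1 - √(1 / 3))| := by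
      rw [sqrt_div_relative_tolerance hai hε0]
      exact (constK_pos hε0 hε1).le
    have h2 := sqrt_sub_le_of_timeT2_le hα hη h3α (hηl _ (by omega) i.2)
      (mul_pos (div_pos (Real.sqrt_pos.2 hai) (by norm_num)) hε0) hK
      (hk₀ (i + 1) (Finset.mem_Icc.2 ⟨by omega, hi⟩))
    refine ⟨sq_ge_of_sqrt_sub_le hai hε0 hε1 h2, ?_⟩
    have := (hd0 i).2
    rwa [max_eq_left (by linarith)] at this
  obtain ⟨hD, hDE⟩ := hlead i₀ (show 0 < L by omega)
  set D := d i₀ ^ 2 with hDdef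
  have ha₀ : a i₀ = lam 1 := by simp [ha, hi₀]
  rw [ha₀] at hD hDE
  have hD34 : 3 / 4 * lam 1 ≤ D := by nlinarith
  have hD0 : 0 < D := lt_of_lt_of_le (by positivity) hD34
  have hmid : ∀ i : Fin n, L ≤ (i : ℕ) → d i ^ 2 / D ≤ 6 * (lam (L + 1) / lam 1) * ε' := by
    intro i hi
    have h1 : d i ^ 2 ≤ ε' * lam (L + 1) :=
      (pow_le_pow_left₀ (hd0 i).1 (hdmono ⟨L, by omega⟩ i (Fin.mk_le_mk.2 hi)) 2).trans
        (factorIter_sq_le_of_le_timeT1 hα hη hε0' hε1' hαlam (hηl _ (by omega) hLn) hk₁)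
    have h2 : 0 < ε' * lam (L + 1) := mul_pos hε0' hpos
    rw [div_le_iff₀ hD0]
    calc d i ^ 2 ≤ 6 * (ε' * lam (L + 1)) * (3 / 4) := by linarith
      _ = 6 * (lam (L + 1) / lam 1) * ε' * (3 / 4 * lam 1) := by field_simp
      _ ≤ _ := by gcongr
  -- Past L' the maximality of L' gives ε' a i ≤ α², so the iterate never exceeds α²/ε'.
  have htail : ∀ i : Fin n, L' ≤ (i : ℕ) → d i ^ 2 / D ≤ 2 * α ^ 2 / (ε' * lam 1) := by
    intro i hi
    have h1 : ε' * a i ≤ α ^ 2 := by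
      by_contra! h
      have : (i : ℕ) + 1 ≤ L' := hL'.2 ⟨Finset.mem_Icc.2 ⟨by omega, i.2⟩, h⟩
      omega
    have h2 : d i ^ 2 ≤ α ^ 2 / ε' := by
      refine (hd0 i).2.trans (max_le ?_ ?_)
      · rw [le_div_iff₀ hε0']; linarith
      · exact le_div_self hα2.le hε0' (by linarith)
    have h3 : 0 < α ^ 2 / ε' := by positivity
    rw [div_le_iff₀ hD0]
    calc d i ^ 2 ≤ 2 * (α ^ 2 / ε') * (3 / 4) := by linarith
      _ = 2 * α ^ 2 / (ε' * lam 1) * (3 / 4 * lam 1) := by field_simp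
      _ ≤ _ := by gcongr
  set c₁ := 6 * (lam (L + 1) / lam 1) * ε' with hc₁
  set c₂ := 2 * α ^ 2 / (ε' * lam 1) with hc₂
  -- The block L ≤ i < L' is a difference of two tail indicators, so that `sum_fin_ite_ge` counts
  -- it.
  have hterm : ∀ i : Fin n, |(if (i : ℕ) < L then a i else 0) / lam 1 - d i ^ 2 / D| ≤
      ε * ((if (i : ℕ) < L then a i else 0) / lam 1) +
        ((if L ≤ (i : ℕ) then c₁ else 0) - (if L' ≤ (i : ℕ) then c₁ else 0)) +
        (if L' ≤ (i : ℕ) then c₂ else 0) := by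
    intro i
    have hnn : 0 ≤ d i ^ 2 / D := by positivity
    rcases lt_or_ge (i : ℕ) L with hi | hi
    · rw [if_pos hi, if_neg (by omega), if_neg (by omega), if_neg (by omega), sub_zero, add_zero,
        add_zero]
      exact abs_ratio_sub_ratio_le hE (ha0 i) hε0 hε1 (hlead i hi).1 (hlead i hi).2 hD hDE
    · rw [if_neg (by omega), if_pos hi, zero_div, mul_zero, zero_add, zero_sub, abs_neg,
        abs_of_nonneg hnn]
      by_cases hi' : L' ≤ (i : ℕ)
      · rw [if_pos hi', if_pos hi', sub_self, zero_add]
        exact htail i hi'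
      · rw [if_neg hi', if_neg hi', sub_zero, add_zero]
        exact hmid i hi
  have htot : |effRank WL - effRank (W₂ k * W₁ k)| ≤ ∑ i : Fin n,
      (ε * ((if (i : ℕ) < L then a i else 0) / lam 1) +
        ((if L ≤ (i : ℕ) then c₁ else 0) - (if L' ≤ (i : ℕ) then c₁ else 0)) +
        (if L' ≤ (i : ℕ) then c₂ else 0)) := by
    rw [hrL, hrW, ← Finset.sum_sub_distrib]
    exact (Finset.abs_sum_le_sum_abs _ _).trans (Finset.sum_le_sum fun i _ => hterm i)
  rw [Finset.sum_add_distrib, Finset.sum_add_distrib,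
    Finset.sum_sub_distrib, ← Finset.mul_sum, ← hrL, sum_fin_ite_ge (by omega),
    sum_fin_ite_ge hL'n, sum_fin_ite_ge hL'n] at htot
  refine htot.trans (le_of_eq ?_)
  rw [hc₁]
  ring

/-! ### The main theorem. -/

theorem theorem3p6
    {n : ℕ} (What : Matrix (Fin n) (Fin n) ℝ) (hsymm : What.IsSymm)
    (lam : ℕ → ℝ) (hspec : IsOrderedSpectrum What lam) (hnonneg : 0 ≤ lam n)
    (L : ℕ) (hL : 1 ≤ L) (hLn : L + 1 ≤ n) (hpos : 0 < lam (L + 1))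
    (ε ε' α η : ℝ) (hε : ε ∈ Set.Ioo (0 : ℝ) 1) (hε' : ε' ∈ Set.Ioo (0 : ℝ) (1 / 3))
    (hα : 0 < α) (hαlam : α ^ 2 < ε' * lam (L + 1))
    (hη : 0 < η) (hηlam : η < (4 * max 1 (lam 1))⁻¹)
    (W₁ W₂ : ℕ → Matrix (Fin n) (Fin n) ℝ) (hGD : IsGradientDescent What α η W₁ W₂)
    (L' : ℕ) (hL' : IsGreatest {l : ℕ | l ∈ Finset.Icc 1 n ∧ α ^ 2 < ε' * lam l} L') :
    -- the effective rank bound on the window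
    (∀ WL : Matrix (Fin n) (Fin n) ℝ, IsBestRankApprox What L WL →
      ∀ k : ℕ, timeT0 lam L hL ε α η ≤ (k : ℝ) → (k : ℝ) ≤ timeT1 (lam (L + 1)) ε' α η →
        |effRank WL - effRank (W₂ k * W₁ k)|
          ≤ ε * effRank WL + 6 * ((L' : ℝ) - (L : ℝ)) * (lam (L + 1) / lam 1) * ε'
            + ((n : ℝ) - (L' : ℝ)) * (2 * α ^ 2 / (ε' * lam 1))) ∧
    -- explicit form of the window, and its non-emptiness
    (1 ≤ lam 1 → 2 * (Real.exp 1 + 1) * α ^ 2 ≤ lam L →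
      (∀ l : ℕ, 1 ≤ l → l + 1 ≤ L →
        1 / decayRate ε η (lam (l + 1)) (lam l)
            * ((⌈√(lam l / 3) * (1 / α)⌉ : ℝ) - (⌈√(lam (l + 1) / 3) * (1 / α)⌉ : ℝ))
          ≤ lam l - lam (l + 1)) →
      timeT0 lam L hL ε α η = timeT2 (lam L) (√(lam L) / 8 * ε) α η ∧
      timeT0 lam L hL ε α η
        = 1 / (2 * η * lam L) * (Real.log (lam L / α ^ 2 - 1) - Real.log 2)
          + (⌈√(lam L / 3) * (1 / α)⌉ : ℝ)
          + constK ε / |Real.log (1 - 2 * η * lam L / 3)| ∧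
      timeT1 (lam (L + 1)) ε' α η
        = 1 / (2 * η * lam (L + 1))
          * (Real.log (lam (L + 1) / α ^ 2 - 1) - Real.log (1 / ε' - 1)) ∧
      (lam (L + 1) < lam L → α < alphaStar ε ε' (lam (L + 1)) (lam L) →
        η < etaStar ε ε' α (lam (L + 1)) (lam L) →
        timeT0 lam L hL ε α η < timeT1 (lam (L + 1)) ε' α η)) := by
  have hηlam' : η * lam 1 ≤ 1 / 4 := by
    have hm : 0 < max 1 (lam 1) := lt_max_of_lt_left one_pos
    have h1 : η * (4 * max 1 (lam 1)) < 1 := by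
      rwa [← one_div, lt_div_iff₀ (by positivity)] at hηlam
    nlinarith [le_max_right 1 (lam 1)]
  have hmono : ∀ {i j : ℕ}, 1 ≤ i → i ≤ j → j ≤ n → lam j ≤ lam i := fun h1 h2 h3 =>
    hspec.1 ⟨h1, h2.trans h3⟩ ⟨h1.trans h2, h3⟩ h2
  refine ⟨fun WL hWL k hk₀ hk₁ => ?_, fun hlam1 hlamL hgap => ?_⟩
  · refine abs_effRank_sub_effRank_le hsymm hspec hnonneg hL hLn hpos hε hε' hα hαlam hη hηlam'
      hGD hL' hWL (fun l hl => ?_) hk₁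
    exact (Finset.le_sup' (fun l => timeT2 (lam l) (√(lam l) / 8 * ε) α η) hl).trans
      ((le_max_right _ _).trans hk₀)
  · have hK := constK_pos hε.1 hε.2
    have hLpos : 0 < lam L := hpos.trans_le (hmono hL (Nat.le_succ L) hLn)
    have hηl : ∀ i, 1 ≤ i → i ≤ n → η * lam i ≤ 1 / 4 := fun i h1 h2 =>
      (mul_le_mul_of_nonneg_left (hmono le_rfl h1 h2) hη.le).trans hηlam'
    -- Consecutive comparisons are chained by induction on the distance m = L - l.
    have hstep : ∀ m l : ℕ, 1 ≤ l → l + m = L →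
        timeT2 (lam l) (√(lam l) / 8 * ε) α η ≤ timeT2 (lam L) (√(lam L) / 8 * ε) α η := by
      intro m
      induction m with
      | zero => rintro l - rfl; exact le_rfl
      | succ m ih =>
        intro l hl hlm
        refine le_trans ?_ (ih (l + 1) (by omega) (by omega))
        exact timeT2_le_of_gap hε.1 hε.2 hα hη
          (hlamL.trans (hmono (by omega) (by omega) (by omega)))
          (hmono hl (Nat.le_succ l) (by omega)) (hηl l hl (by omega)) (hgap l hl (by omega))
    -- As λ₁ ≥ 1, the tolerance √λ₁ ε/8 is finer than λ₁/2, and a finer tolerance takes longer.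
    have hfirst : timeT2 (lam 1) (lam 1 / 2) α η ≤ timeT2 (lam 1) (√(lam 1) / 8 * ε) α η := by
      have h1 : 0 < lam 1 := by linarith
      have hε0 := hε.1
      have hs : 1 ≤ √(lam 1) := Real.one_le_sqrt.2 hlam1
      rw [timeT2, timeT2]
      gcongr
      have h2 : √(lam 1) / 8 * ε ≤ √(lam 1) / 8 := mul_le_of_le_one_right (by positivity) hε.2.le
      have h3 : √(lam 1) ≤ lam 1 := by
        nlinarith [Real.sq_sqrt h1.le]
      linarith
    have hT0 : timeT0 lam L hL ε α η = timeT2 (lam L) (√(lam L) / 8 * ε) α η := by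
      rw [timeT0]
      apply le_antisymm
      · refine max_le (hfirst.trans (hstep (L - 1) 1 le_rfl (by omega))) ?_
        refine Finset.sup'_le _ _ fun l hl => ?_
        rw [Finset.mem_Icc] at hl
        exact hstep (L - l) l hl.1 (by omega)
      · exact (Finset.le_sup' (fun l => timeT2 (lam l) (√(lam l) / 8 * ε) α η)
          (Finset.mem_Icc.2 ⟨hL, le_rfl⟩)).trans (le_max_right _ _)
    refine ⟨hT0, ?_, rfl, fun _ _ hηs => ?_⟩
    · rw [hT0, timeT2_relative_tolerance hLpos hε.1]
    · rw [hT0]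
      exact timeT2_lt_timeT1 hK hε.1 hα hη hLpos (hηl L hL (by omega)) hηs
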